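/- **Setting.** Let $V$ be the set of càdlàg functions $x:[0,+\infty)\to\mathbb R$ (right-continuous at every $t\ge 0$, with left limits $x_{t-}$ at every $t>0$) with locally finite total variation, $\Delta x_s=x_s-x_{s-}$. *Crossings.* For $y\in\mathbb R$, $c>0$ and $0\le s\le t$ put $\sigma_0=s$ and, for $n\ge 0$, $$\tau_n=\inf\{u\in[\sigma_n,t]: x_u\ge y+c/2\},\qquad \sigma_{n+1}=\inf\{u\in[\tau_n,t]: x_u<y-c/2\}$$ ($\inf\emptyset=+\infty$, $[+\infty,t]=\emptyset$). Let $d^{y,c}(x,[s,t])=\max\{n:\sigma_n\le t\}$, $u^{y,c}(x,[s,t])=d^{-y,c}(-x,[s,t])$, $n^{y,c}=u^{y,c}+d^{y,c}$. The numbers of downcrossings, upcrossings and crossings of the level $y$ by $x$ on $[s,t]$ are $d^y=\lim_{c\to0+}d^{y,c}$, $u^y=\lim_{c\to0+}u^{y,c}$, $n^y=\lim_{c\to0+}n^{y,c}$, with values in $\{0,1,2,\dots\}\cup\{+\infty\}$. *Measures.* The continuous part of $x$ is $x^{cont}_t=x_t-\sum_{0<s\le t}\Delta x_s$. The measures $(dx_s)_+$,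 $(dx_s)_-$, $|dx_s|$ on $[0,+\infty)$ give mass $0$ to $\{0\}$, and to $(a,b]$ the mass $\sup\sum_i(x_{t_{i+1}}-x_{t_i})_+$, $\sup\sum_i(x_{t_{i+1}}-x_{t_i})_-$, $\sup\sum_i|x_{t_{i+1}}-x_{t_i}|$ respectively, the suprema being over the finite partitions $a=t_0\le\dots\le t_n=b$; likewise for $x^{cont}$. Moreover $\int_A h_s\,dx_s:=\int_A h_s(dx_s)_+-\int_A h_s(dx_s)_-$, likewise for $x^{cont}$. **Theorem.** Let $x\in V$, let $t>0$ and let $g:\mathbb R\to\mathbb R$ be Borel measurable and locally bounded. Write $u^z,d^z,n^z$ for $u^z(x,[0,t])$, $d^z(x,[0,t])$, $n^z(x,[0,t])$. These are Borel functions of $z$, finite for almost every $z$; all the integrals and (unconditional) sums below converge, and: 1. $$\int_{\mathbb R}u^z g(z)\,dz=\int_{(0,t]}g(x_{s-})(dx_s)_++\sum_{0<s\le t,\ \Delta x_s>0}\int_{x_{s-}}^{x_s}\{g(z)-g(x_{s-})\}\,dz$$ $$=\int_{(0,t]}g(x_{s-})(dx^{cont}_s)_++\sum_{0<s\le t,\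 \Delta x_s>0}\int_{x_{s-}}^{x_s}g(z)\,dz=\int_{(0,t]}g(x_s)(dx^{cont}_s)_++\sum_{0<s\le t,\ \Delta x_s>0}\int_{x_{s-}}^{x_s}g(z)\,dz.$$ 2. $$\int_{\mathbb R}d^z g(z)\,dz=\int_{(0,t]}g(x_{s-})(dx_s)_-+\sum_{0<s\le t,\ \Delta x_s<0}\int_{x_s}^{x_{s-}}\{g(z)-g(x_{s-})\}\,dz$$ $$=\int_{(0,t]}g(x_{s-})(dx^{cont}_s)_-+\sum_{0<s\le t,\ \Delta x_s<0}\int_{x_s}^{x_{s-}}g(z)\,dz=\int_{(0,t]}g(x_s)(dx^{cont}_s)_-+\sum_{0<s\le t,\ \Delta x_s<0}\int_{x_s}^{x_{s-}}g(z)\,dz.$$ 3. $$\int_{\mathbb R}(u^z-d^z)g(z)\,dz=\int_{(0,t]}g(x_{s-})\,dx_s+\sum_{0<s\le t,\ \Delta x_s\ne0}\int_{x_{s-}}^{x_s}\{g(z)-g(x_{s-})\}\,dz$$ $$=\int_{(0,t]}g(x_{s-})\,dx^{cont}_s+\sum_{0<s\le t,\ \Delta x_s\ne0}\int_{x_{s-}}^{x_s}g(z)\,dz=\int_{(0,t]}g(x_s)\,dx^{cont}_s+\sum_{0<s\le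 t,\ \Delta x_s\ne0}\int_{x_{s-}}^{x_s}g(z)\,dz.$$ 4. $$\int_{\mathbb R}n^z g(z)\,dz=\int_{(0,t]}g(x_{s-})|dx_s|+\sum_{0<s\le t,\ \Delta x_s\ne0}\int_{x_{s-}\wedge x_s}^{x_{s-}\vee x_s}\{g(z)-g(x_{s-})\}\,dz$$ $$=\int_{(0,t]}g(x_{s-})|dx^{cont}_s|+\sum_{0<s\le t,\ \Delta x_s\ne0}\int_{x_{s-}\wedge x_s}^{x_{s-}\vee x_s}g(z)\,dz=\int_{(0,t]}g(x_s)|dx^{cont}_s|+\sum_{0<s\le t,\ \Delta x_s\ne0}\int_{x_{s-}\wedge x_s}^{x_{s-}\vee x_s}g(z)\,dz.$$ In particular $z\mapsto u^z$ is a density of the occupation measure built from the upward variation: for every Borel set $A\subseteq\mathbb R$, $$\int_A u^z\,dz=\int_{\{s\in(0,t]:\,x_s\in A\}}(dx^{cont}_s)_++\sum_{0<s\le t,\ \Delta x_s>0}\mathrm{Leb}\big(A\cap(x_{s-},x_s)\big),$$ and likewise for $d^z$ with $(dx^{cont}_s)_-$ and the negative jumps, and for $n^z$ with $|dx^{cont}_s|$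 and all the jumps. -/

import Mathlib

open Set Filter Topology MeasureTheory
open scoped NNReal ENNReal

namespace LevelCrossing

/-- `x : [0, ∞) → ℝ` is càdlàg: right-continuous at each `t ≥ 0`, with left limits at each `t > 0`. -/
def IsCadlag (x : ℝ≥0 → ℝ) : Prop :=
  (∀ t, ContinuousWithinAt x (Ici t) t) ∧ ∀ t, 0 < t → ∃ l, Tendsto x (𝓝[<] t) (𝓝 l)

/-- The class `V`: càdlàg functions on `[0, ∞)` with locally finite total variation. -/
structure IsCadlagLFV (x : ℝ≥0 → ℝ) : Prop where
  cadlag : IsCadlag x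
  locallyFiniteVariation : LocallyBoundedVariationOn x univ

/-- A real function is locally bounded: every point has a neighbourhood on which it is bounded. -/
def IsLocallyBounded (g : ℝ → ℝ) : Prop :=
  ∀ a, ∃ U ∈ 𝓝 a, ∃ C, ∀ z ∈ U, |g z| ≤ C

/-! ### Crossings of an interval and of a level -/

/-- `inf {u ∈ [a, t] : x u ≥ y + c / 2}`, with `inf ∅ = ∞` and `[∞, t] = ∅`. -/
noncomputable def firstAbove (x : ℝ≥0 → ℝ) (t : ℝ≥0) (y c : ℝ) (a : ℝ≥0∞) : ℝ≥0∞ :=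
  sInf {u | ∃ r : ℝ≥0, u = r ∧ a ≤ r ∧ r ≤ t ∧ y + c / 2 ≤ x r}

/-- `inf {u ∈ [a, t] : x u < y - c / 2}`, with `inf ∅ = ∞` and `[∞, t] = ∅`. -/
noncomputable def firstBelow (x : ℝ≥0 → ℝ) (t : ℝ≥0) (y c : ℝ) (a : ℝ≥0∞) : ℝ≥0∞ :=
  sInf {u | ∃ r : ℝ≥0, u = r ∧ a ≤ r ∧ r ≤ t ∧ x r < y - c / 2}

/-- The times `σ₀ = s`, `σₙ₊₁ = firstBelow (firstAbove σₙ)`; for `n ≥ 1`, `σₙ` is the time at which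
the `n`-th downcrossing of `[y - c / 2, y + c / 2]` on `[s, t]` is completed. -/
noncomputable def downTime (x : ℝ≥0 → ℝ) (s t : ℝ≥0) (y c : ℝ) : ℕ → ℝ≥0∞
  | 0 => s
  | n + 1 => firstBelow x t y c (firstAbove x t y c (downTime x s t y c n))

/-- Number of downcrossings of the interval `[y - c / 2, y + c / 2]` on `[s, t]`:
the largest `n` with `σₙ ≤ t`. -/
noncomputable def downCrossingsIntv (x : ℝ≥0 → ℝ) (s t : ℝ≥0) (y c : ℝ) : ℕ∞ :=
  ⨆ (n : ℕ) (_ : downTime x s t y c n ≤ t), (n : ℕ∞)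

/-- Number of upcrossings of the interval `[y - c / 2, y + c / 2]` on `[s, t]`. -/
noncomputable def upCrossingsIntv (x : ℝ≥0 → ℝ) (s t : ℝ≥0) (y c : ℝ) : ℕ∞ :=
  downCrossingsIntv (fun r => -x r) s t (-y) c

/-- Number of crossings of the interval `[y - c / 2, y + c / 2]` on `[s, t]`. -/
noncomputable def crossingsIntv (x : ℝ≥0 → ℝ) (s t : ℝ≥0) (y c : ℝ) : ℕ∞ :=
  upCrossingsIntv x s t y c + downCrossingsIntv x s t y c

/-- Number of downcrossings of the level `y` on `[s, t]`: the limit as `c → 0+`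
(it exists, see `tendsto_downCrossings`). -/
noncomputable def downCrossings (x : ℝ≥0 → ℝ) (s t : ℝ≥0) (y : ℝ) : ℕ∞ :=
  limUnder (𝓝[>] (0 : ℝ)) (fun c => downCrossingsIntv x s t y c)

/-- Number of upcrossings of the level `y` on `[s, t]`: the limit as `c → 0+`. -/
noncomputable def upCrossings (x : ℝ≥0 → ℝ) (s t : ℝ≥0) (y : ℝ) : ℕ∞ :=
  limUnder (𝓝[>] (0 : ℝ)) (fun c => upCrossingsIntv x s t y c)

/-- Number of crossings of the level `y` on `[s, t]`: the limit as `c → 0+`. -/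
noncomputable def crossings (x : ℝ≥0 → ℝ) (s t : ℝ≥0) (y : ℝ) : ℕ∞ :=
  limUnder (𝓝[>] (0 : ℝ)) (fun c => crossingsIntv x s t y c)

theorem downTime_mono (x : ℝ≥0 → ℝ) (s t : ℝ≥0) (y : ℝ) {c c' : ℝ} (h : c ≤ c') (n : ℕ) :
    downTime x s t y c n ≤ downTime x s t y c' n := by
  induction n with
  | zero => exact le_rfl
  | succ n ih =>
    have h1 : firstAbove x t y c (downTime x s t y c n) ≤
        firstAbove x t y c' (downTime x s t y c' n) := by
      apply sInf_le_sInf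
      rintro u ⟨r, hu, ha, hr, hx⟩
      exact ⟨r, hu, ih.trans ha, hr, by linarith⟩
    apply sInf_le_sInf
    rintro u ⟨r, hu, ha, hr, hx⟩
    exact ⟨r, hu, h1.trans ha, hr, by linarith⟩

theorem antitone_downCrossingsIntv (x : ℝ≥0 → ℝ) (s t : ℝ≥0) (y : ℝ) :
    Antitone (fun c => downCrossingsIntv x s t y c) := fun _ _ h =>
  iSup_mono fun n => iSup_mono' fun hn => ⟨(downTime_mono x s t y h n).trans hn, le_rfl⟩

theorem tendsto_downCrossings (x : ℝ≥0 → ℝ) (s t : ℝ≥0) (y : ℝ) :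
    Tendsto (fun c => downCrossingsIntv x s t y c) (𝓝[>] (0 : ℝ)) (𝓝 (downCrossings x s t y)) :=
  tendsto_nhds_limUnder ⟨_, (antitone_downCrossingsIntv x s t y).tendsto_nhdsGT 0⟩

theorem tendsto_upCrossings (x : ℝ≥0 → ℝ) (s t : ℝ≥0) (y : ℝ) :
    Tendsto (fun c => upCrossingsIntv x s t y c) (𝓝[>] (0 : ℝ)) (𝓝 (upCrossings x s t y)) :=
  tendsto_nhds_limUnder
    ⟨_, (antitone_downCrossingsIntv (fun r => -x r) s t (-y)).tendsto_nhdsGT 0⟩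

theorem tendsto_crossings (x : ℝ≥0 → ℝ) (s t : ℝ≥0) (y : ℝ) :
    Tendsto (fun c => crossingsIntv x s t y c) (𝓝[>] (0 : ℝ)) (𝓝 (crossings x s t y)) := by
  refine tendsto_nhds_limUnder ⟨_, Antitone.tendsto_nhdsGT ?_ 0⟩
  exact fun _ _ h => add_le_add (antitone_downCrossingsIntv (fun r => -x r) s t (-y) h)
    (antitone_downCrossingsIntv x s t y h)

/-! ### Jumps and the continuous part -/

/-- The jump `Δx_s = x_s - x_{s-}` (it is `0` at `s = 0`). -/
noncomputable def jump (x : ℝ≥0 → ℝ) (s : ℝ≥0) : ℝ := x s - Function.leftLim x s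

/-- Times of positive jumps in `(0, t]`. -/
def upJumps (x : ℝ≥0 → ℝ) (t : ℝ≥0) : Set ℝ≥0 := {s | 0 < s ∧ s ≤ t ∧ 0 < jump x s}

/-- Times of negative jumps in `(0, t]`. -/
def downJumps (x : ℝ≥0 → ℝ) (t : ℝ≥0) : Set ℝ≥0 := {s | 0 < s ∧ s ≤ t ∧ jump x s < 0}

/-- Times of jumps in `(0, t]`. -/
def jumps (x : ℝ≥0 → ℝ) (t : ℝ≥0) : Set ℝ≥0 := {s | 0 < s ∧ s ≤ t ∧ jump x s ≠ 0}

/-- The continuous part `x^cont t = x t - ∑_{0 < s ≤ t} Δx_s` (an unconditional sum). -/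
noncomputable def contPart (x : ℝ≥0 → ℝ) (t : ℝ≥0) : ℝ := x t - ∑' s : Ioc 0 t, jump x s

/-! ### Upward, downward and total variation, and the associated measures -/

/-- Upward variation on `[a, b]`: supremum over the partitions `a = u 0 ≤ ⋯ ≤ u n = b` of
`∑ (x (u (i + 1)) - x (u i))₊`. -/
noncomputable def upVariation (x : ℝ≥0 → ℝ) (a b : ℝ≥0) : ℝ≥0∞ :=
  ⨆ (n : ℕ) (u : ℕ → ℝ≥0) (_ : Monotone u) (_ : u 0 = a) (_ : u n = b),
    ∑ i ∈ Finset.range n, ENNReal.ofReal (x (u (i + 1)) - x (u i))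

/-- Downward variation on `[a, b]`: supremum over the partitions `a = u 0 ≤ ⋯ ≤ u n = b` of
`∑ (x (u (i + 1)) - x (u i))₋`. -/
noncomputable def downVariation (x : ℝ≥0 → ℝ) (a b : ℝ≥0) : ℝ≥0∞ :=
  ⨆ (n : ℕ) (u : ℕ → ℝ≥0) (_ : Monotone u) (_ : u 0 = a) (_ : u n = b),
    ∑ i ∈ Finset.range n, ENNReal.ofReal (-(x (u (i + 1)) - x (u i)))

/-- Total variation on `[a, b]`. -/
noncomputable def totalVariation (x : ℝ≥0 → ℝ) (a b : ℝ≥0) : ℝ≥0∞ := eVariationOn x (Icc a b)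

/-- `μ` gives mass `0` to `{0}` and mass `v a b` to `(a, b]` for all `0 ≤ a < b`. -/
def IsMeasureOf (v : ℝ≥0 → ℝ≥0 → ℝ≥0∞) (μ : Measure ℝ≥0) : Prop :=
  μ {0} = 0 ∧ ∀ a b, a < b → μ (Ioc a b) = v a b

open Classical in
/-- The measure on `[0, ∞)` giving mass `0` to `{0}` and `v a b` to each `(a, b]` (by convention `0`
if there is none; there is one in all cases of interest, see `isMeasureOf_upMeasure` etc.). -/
noncomputable def intervalMeasure (v : ℝ≥0 → ℝ≥0 → ℝ≥0∞) : Measure ℝ≥0 :=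
  if h : ∃ μ, IsMeasureOf v μ then h.choose else 0

/-- The measure `(dx)₊`. -/
noncomputable def upMeasure (x : ℝ≥0 → ℝ) : Measure ℝ≥0 := intervalMeasure (upVariation x)

/-- The measure `(dx)₋`. -/
noncomputable def downMeasure (x : ℝ≥0 → ℝ) : Measure ℝ≥0 := intervalMeasure (downVariation x)

/-- The measure `|dx|`. -/
noncomputable def variationMeasure (x : ℝ≥0 → ℝ) : Measure ℝ≥0 :=
  intervalMeasure (totalVariation x)

/-- The signed integral `∫_A h dx = ∫_A h (dx)₊ - ∫_A h (dx)₋`. -/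
noncomputable def signedIntegral (x : ℝ≥0 → ℝ) (A : Set ℝ≥0) (h : ℝ≥0 → ℝ) : ℝ :=
  (∫ s in A, h s ∂(upMeasure x)) - ∫ s in A, h s ∂(downMeasure x)

/-! ### Existence of the measures -/

theorem intervalMeasure_spec {v : ℝ≥0 → ℝ≥0 → ℝ≥0∞} (h : ∃ μ, IsMeasureOf v μ) :
    IsMeasureOf v (intervalMeasure v) := by
  rw [intervalMeasure, dif_pos h]
  exact h.choose_spec

theorem exists_isMeasureOf {v : ℝ≥0 → ℝ≥0 → ℝ≥0∞} (F : ℝ≥0 → ℝ) (hF : Monotone F)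
    (hc : ∀ t, ContinuousWithinAt F (Ici t) t)
    (hv : ∀ a b, a < b → v a b = ENNReal.ofReal (F b - F a)) : ∃ μ, IsMeasureOf v μ := by
  let S : StieltjesFunction ℝ≥0 := ⟨F, hF, hc⟩
  refine ⟨S.measure, ?_, fun a b hab => ?_⟩
  · have : (botSet : Set ℝ≥0) = {0} :=
      botSet_eq_singleton_of_isBot (fun b => bot_le)
    rw [← this]
    exact S.measure_botSet
  · rw [S.measure_Ioc, hv a b hab]

theorem totalVariation_ne_top {x : ℝ≥0 → ℝ} (hx : IsCadlagLFV x) (a b : ℝ≥0) :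
    totalVariation x a b ≠ ∞ := by
  have := hx.locallyFiniteVariation a b (mem_univ a) (mem_univ b)
  rwa [univ_inter] at this

theorem totalVariation_add (x : ℝ≥0 → ℝ) {a b c : ℝ≥0} (hab : a ≤ b) (hbc : b ≤ c) :
    totalVariation x a b + totalVariation x b c = totalVariation x a c := by
  simpa [totalVariation] using eVariationOn.Icc_add_Icc x (s := univ) hab hbc (mem_univ b)

theorem totalVariation_sub {x : ℝ≥0 → ℝ} (hx : IsCadlagLFV x) {a b : ℝ≥0} (hab : a ≤ b) :
    (totalVariation x 0 b).toReal - (totalVariation x 0 a).toReal =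
      (totalVariation x a b).toReal := by
  rw [← totalVariation_add x (zero_le (a := a)) hab,
    ENNReal.toReal_add (totalVariation_ne_top hx _ _) (totalVariation_ne_top hx _ _)]
  ring

theorem abs_sub_le_totalVariation {x : ℝ≥0 → ℝ} (hx : IsCadlagLFV x) {a b : ℝ≥0} (hab : a ≤ b) :
    |x b - x a| ≤ (totalVariation x a b).toReal := by
  have h := eVariationOn.edist_le x (s := Icc a b) (right_mem_Icc.2 hab) (left_mem_Icc.2 hab)
  change _ ≤ totalVariation x a b at h
  rw [edist_dist, ENNReal.ofReal_le_iff_le_toReal (totalVariation_ne_top hx a b)] at h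
  rwa [Real.dist_eq] at h

theorem tendsto_totalVariation {x : ℝ≥0 → ℝ} (hx : IsCadlagLFV x) (t : ℝ≥0) :
    Tendsto (fun b => (totalVariation x t b).toReal) (𝓝[≥] t) (𝓝 0) := by
  have h := hx.locallyFiniteVariation.tendsto_eVariationOn_Icc_right (x := t) (l := x t)
    (by simpa only [univ_inter] using ((hx.cadlag.1 t).mono Ioi_subset_Ici_self).tendsto) (mem_univ t)
  simp only [univ_inter, edist_self] at h
  have h2 := (ENNReal.tendsto_toReal ENNReal.zero_ne_top).comp h
  rw [← Ioi_insert, nhdsWithin_insert]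
  refine Tendsto.sup ?_ h2
  rw [tendsto_pure_left]
  intro s hs
  have : (totalVariation x t t).toReal = 0 := by
    simp [totalVariation, eVariationOn.subsingleton]
  rw [this]
  exact mem_of_mem_nhds hs

theorem continuousWithinAt_totalVariation {x : ℝ≥0 → ℝ} (hx : IsCadlagLFV x) (t : ℝ≥0) :
    ContinuousWithinAt (fun b => (totalVariation x 0 b).toReal) (Ici t) t := by
  have h := (tendsto_totalVariation hx t).const_add (totalVariation x 0 t).toReal
  rw [add_zero] at h
  refine h.congr' ?_
  filter_upwards [self_mem_nhdsWithin] with b hb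
  rw [← totalVariation_sub hx hb]
  ring

theorem isMeasureOf_variationMeasure {x : ℝ≥0 → ℝ} (hx : IsCadlagLFV x) :
    IsMeasureOf (totalVariation x) (variationMeasure x) := by
  refine intervalMeasure_spec (exists_isMeasureOf (fun b => (totalVariation x 0 b).toReal)
    (fun a b hab => ?_) (continuousWithinAt_totalVariation hx) fun a b hab => ?_)
  · have := totalVariation_sub hx hab
    have h0 : 0 ≤ (totalVariation x a b).toReal := ENNReal.toReal_nonneg
    dsimp only
    linarith
  · rw [totalVariation_sub hx hab.le, ENNReal.ofReal_toReal (totalVariation_ne_top hx a b)]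

theorem sum_partition (x : ℝ≥0 → ℝ) (u : ℕ → ℝ≥0) (n : ℕ) :
    ∑ i ∈ Finset.range n, ENNReal.ofReal (x (u (i + 1)) - x (u i)) =
      ENNReal.ofReal (((∑ i ∈ Finset.range n, |x (u (i + 1)) - x (u i)|) +
        (x (u n) - x (u 0))) / 2) := by
  have h : ((∑ i ∈ Finset.range n, |x (u (i + 1)) - x (u i)|) + (x (u n) - x (u 0))) / 2 =
      ∑ i ∈ Finset.range n, max (x (u (i + 1)) - x (u i)) 0 := by
    rw [← Finset.sum_range_sub (fun i => x (u i)) n, ← Finset.sum_add_distrib, Finset.sum_div]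
    refine Finset.sum_congr rfl fun i _ => ?_
    rcases le_total 0 (x (u (i + 1)) - x (u i)) with h | h
    · rw [abs_of_nonneg h, max_eq_left h]; ring
    · rw [abs_of_nonpos h, max_eq_right h]; ring
  rw [h, ENNReal.ofReal_sum_of_nonneg fun i _ => le_max_right _ _]
  refine Finset.sum_congr rfl fun i _ => ?_
  rcases le_total 0 (x (u (i + 1)) - x (u i)) with h | h
  · rw [max_eq_left h]
  · rw [max_eq_right h, ENNReal.ofReal_of_nonpos h, ENNReal.ofReal_zero]

theorem upVariation_eq {x : ℝ≥0 → ℝ} (hx : IsCadlagLFV x) {a b : ℝ≥0} (hab : a ≤ b) :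
    upVariation x a b = ENNReal.ofReal (((totalVariation x a b).toReal + (x b - x a)) / 2) := by
  have habs (p q : ℝ≥0) : edist (x p) (x q) = ENNReal.ofReal |x p - x q| := by
    rw [edist_dist, Real.dist_eq]
  apply le_antisymm
  · refine iSup_le fun n => iSup_le fun u => iSup_le fun hu => iSup_le fun h0 => iSup_le fun hn => ?_
    rw [sum_partition, h0, hn]
    apply ENNReal.ofReal_le_ofReal
    have h := eVariationOn.sum_le_of_monotoneOn_Icc (f := x) (s := Icc a b) (m := 0) (n := n)
      (u := u) (hu.monotoneOn _) (fun i hi => ⟨h0 ▸ hu hi.1, hn ▸ hu hi.2⟩)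
    simp only [habs, ← Finset.range_eq_Ico] at h
    change _ ≤ totalVariation x a b at h
    rw [← ENNReal.ofReal_sum_of_nonneg fun i _ => abs_nonneg _,
      ENNReal.ofReal_le_iff_le_toReal (totalVariation_ne_top hx a b)] at h
    linarith
  · by_cases htop : upVariation x a b = ∞
    · simp [htop]
    rw [ENNReal.ofReal_le_iff_le_toReal htop]
    suffices H : totalVariation x a b ≤
        ENNReal.ofReal (2 * (upVariation x a b).toReal - (x b - x a)) by
      have h1 : |x b - x a| ≤ (totalVariation x a b).toReal := abs_sub_le_totalVariation hx hab
      by_cases hpos : 0 ≤ 2 * (upVariation x a b).toReal - (x b - x a)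
      · have := ENNReal.toReal_le_of_le_ofReal hpos H
        linarith
      · exfalso
        have h2 : ENNReal.ofReal (x b - x a) ≤ upVariation x a b := by
          refine le_trans ?_ (le_iSup_of_le 1 (le_iSup_of_le (fun i => if i = 0 then a else b)
            (le_iSup_of_le ?_ (le_iSup_of_le (by simp) (le_iSup_of_le (by simp) le_rfl)))))
          · simp
          · intro i j hij
            by_cases hi : i = 0 <;> by_cases hj : j = 0 <;> simp [hi, hj, hab]
            omega
        rw [ENNReal.ofReal_le_iff_le_toReal htop] at h2
        have h3 : 0 ≤ (upVariation x a b).toReal := ENNReal.toReal_nonneg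
        linarith
    refine iSup_le fun p => ?_
    obtain ⟨n, u, hu, hus⟩ := p
    let w : ℕ → ℝ≥0 := fun i => if i = 0 then a else if i ≤ n + 1 then u (i - 1) else b
    have hw : Monotone w := by
      refine monotone_nat_of_le_succ fun i => ?_
      rcases Nat.eq_zero_or_pos i with rfl | hi
      · simpa [w] using (hus 0).1
      · by_cases h1 : i + 1 ≤ n + 1
        · have h2 : i ≤ n + 1 := by omega
          simp only [w, hi.ne', h1, h2, if_true, if_false, Nat.succ_ne_zero]
          exact hu (by omega)
        · by_cases h2 : i ≤ n + 1
          · simp only [w, hi.ne', h1, h2, if_true, if_false, Nat.succ_ne_zero]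
            exact (hus _).2
          · simp [w, hi.ne', h1, h2]
    have hsum : ∑ i ∈ Finset.range n, |x (u (i + 1)) - x (u i)| ≤
        ∑ i ∈ Finset.range (n + 2), |x (w (i + 1)) - x (w i)| := by
      rw [Finset.sum_range_succ, Finset.sum_range_succ']
      have : ∑ i ∈ Finset.range n, |x (u (i + 1)) - x (u i)| =
          ∑ i ∈ Finset.range n, |x (w (i + 1 + 1)) - x (w (i + 1))| := by
        refine Finset.sum_congr rfl fun i hi => ?_
        rw [Finset.mem_range] at hi
        have h1 : i + 1 ≤ n + 1 := by omega
        have h2 : i + 1 + 1 ≤ n + 1 := by omega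
        simp only [w, h1, h2, if_true, if_false, Nat.succ_ne_zero, Nat.add_sub_cancel]
      rw [this]
      have ha := abs_nonneg (x (w (0 + 1)) - x (w 0))
      have hb := abs_nonneg (x (w (n + 1 + 1)) - x (w (n + 1)))
      linarith
    have hle : ∑ i ∈ Finset.range (n + 2), ENNReal.ofReal (x (w (i + 1)) - x (w i)) ≤
        upVariation x a b :=
      le_iSup_of_le (n + 2) (le_iSup_of_le w (le_iSup_of_le hw (le_iSup_of_le (by simp [w])
        (le_iSup_of_le (by simp [w]) le_rfl))))
    have h0 : w 0 = a := by simp [w]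
    have hn : w (n + 2) = b := by simp [w]
    rw [sum_partition, ENNReal.ofReal_le_iff_le_toReal htop, h0, hn] at hle
    simp only [habs]
    rw [← ENNReal.ofReal_sum_of_nonneg fun i _ => abs_nonneg _]
    apply ENNReal.ofReal_le_ofReal
    linarith

theorem isMeasureOf_upMeasure {x : ℝ≥0 → ℝ} (hx : IsCadlagLFV x) :
    IsMeasureOf (upVariation x) (upMeasure x) := by
  refine intervalMeasure_spec
    (exists_isMeasureOf (fun b => ((totalVariation x 0 b).toReal + x b) / 2)
      (fun a b hab => ?_)
      (fun t => ((continuousWithinAt_totalVariation hx t).add (hx.cadlag.1 t)).div_const 2)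
      fun a b hab => ?_)
  · have h := totalVariation_sub hx hab
    have h' := (abs_le.1 (abs_sub_le_totalVariation hx hab)).1
    dsimp only
    linarith
  · rw [upVariation_eq hx hab.le, ← totalVariation_sub hx hab.le]
    congr 1
    ring

theorem IsCadlagLFV.neg {x : ℝ≥0 → ℝ} (hx : IsCadlagLFV x) : IsCadlagLFV (fun s => -x s) := by
  refine ⟨⟨fun t => (hx.cadlag.1 t).neg, fun t ht => ?_⟩, fun a b ha hb => ?_⟩
  · obtain ⟨l, hl⟩ := hx.cadlag.2 t ht
    exact ⟨-l, hl.neg⟩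
  · have h := hx.locallyFiniteVariation a b ha hb
    simpa [BoundedVariationOn, eVariationOn, edist_neg_neg] using h

theorem downVariation_eq (x : ℝ≥0 → ℝ) (a b : ℝ≥0) :
    downVariation x a b = upVariation (fun s => -x s) a b := by
  simp only [downVariation, upVariation, neg_sub, sub_neg_eq_add, neg_add_eq_sub]

theorem isMeasureOf_downMeasure {x : ℝ≥0 → ℝ} (hx : IsCadlagLFV x) :
    IsMeasureOf (downVariation x) (downMeasure x) := by
  have h : downVariation x = upVariation (fun s => -x s) :=
    funext fun a => funext fun b => downVariation_eq x a b
  rw [downMeasure, h]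
  exact isMeasureOf_upMeasure hx.neg

/-! ### The continuous part has locally finite variation -/

theorem sum_abs_jump_le {x : ℝ≥0 → ℝ} (hx : IsCadlagLFV x) {a b : ℝ≥0} (hab : a ≤ b)
    (F : Finset ℝ≥0) (hF : ∀ s ∈ F, s ∈ Ioc a b) :
    ∑ s ∈ F, |jump x s| ≤ (totalVariation x a b).toReal := by
  let G : ℝ≥0 → ℝ := fun b => (totalVariation x 0 b).toReal
  have hG : Monotone G := fun p q hpq => by
    have := totalVariation_sub hx hpq
    have h0 : 0 ≤ (totalVariation x p q).toReal := ENNReal.toReal_nonneg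
    change (totalVariation x 0 p).toReal ≤ (totalVariation x 0 q).toReal
    linarith
  let S : StieltjesFunction ℝ≥0 := ⟨G, hG, continuousWithinAt_totalVariation hx⟩
  have hj : ∀ s ∈ F, ENNReal.ofReal |jump x s| ≤ S.measure {s} := by
    intro s hs
    rw [S.measure_singleton]
    apply ENNReal.ofReal_le_ofReal
    have hs0 : 0 < s := lt_of_le_of_lt zero_le (hF s hs).1
    have hne : (𝓝[<] s).NeBot := nhdsLT_neBot_of_exists_lt ⟨0, hs0⟩
    obtain ⟨l, hl⟩ := hx.cadlag.2 s hs0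
    have hl' := leftLim_eq_of_tendsto hl
    have hGl := hG.tendsto_leftLim s
    have h1 : Tendsto (fun r => |x s - x r|) (𝓝[<] s) (𝓝 |x s - l|) :=
      (hl.const_sub (x s)).abs
    have h2 : Tendsto (fun r => G s - G r) (𝓝[<] s) (𝓝 (G s - Function.leftLim G s)) :=
      hGl.const_sub (G s)
    rw [jump, hl']
    refine le_of_tendsto_of_tendsto h1 h2 ?_
    filter_upwards [self_mem_nhdsWithin] with r hr
    have h3 := abs_sub_le_totalVariation hx (le_of_lt hr)
    rwa [← totalVariation_sub hx (le_of_lt hr)] at h3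
  rw [← ENNReal.ofReal_le_iff_le_toReal (totalVariation_ne_top hx a b),
    ENNReal.ofReal_sum_of_nonneg fun i _ => abs_nonneg _]
  calc ∑ s ∈ F, ENNReal.ofReal |jump x s| ≤ ∑ s ∈ F, S.measure {s} := Finset.sum_le_sum hj
    _ = S.measure F := by rw [sum_measure_singleton]
    _ ≤ S.measure (Ioc a b) := measure_mono hF
    _ = totalVariation x a b := by
      rw [S.measure_Ioc]
      change ENNReal.ofReal ((totalVariation x 0 b).toReal - (totalVariation x 0 a).toReal) = _
      rw [totalVariation_sub hx hab, ENNReal.ofReal_toReal (totalVariation_ne_top hx a b)]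

theorem summable_jump {x : ℝ≥0 → ℝ} (hx : IsCadlagLFV x) (a b : ℝ≥0) :
    Summable (fun s : Ioc a b => |jump x s|) := by
  rcases le_or_gt a b with hab | hab
  · refine summable_of_sum_le (c := (totalVariation x a b).toReal) (fun _ => abs_nonneg _)
      fun F => ?_
    have h := sum_abs_jump_le hx hab (F.map (Function.Embedding.subtype _))
      (fun s hs => by
        obtain ⟨r, -, rfl⟩ := Finset.mem_map.1 hs
        exact r.2)
    simpa using h
  · have : IsEmpty (Ioc a b) := by
      rw [Ioc_eq_empty (not_lt.2 hab.le)]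
      infer_instance
    exact summable_empty

theorem abs_contPart_sub_le {x : ℝ≥0 → ℝ} (hx : IsCadlagLFV x) {a b : ℝ≥0} (hab : a ≤ b) :
    |contPart x b - contPart x a| ≤ 2 * (totalVariation x a b).toReal := by
  have h1 : ∑' s : Ioc 0 b, jump x s = (∑' s : Ioc 0 a, jump x s) + ∑' s : Ioc a b, jump x s := by
    rw [← Ioc_union_Ioc_eq_Ioc (zero_le (a := a)) hab]
    exact Summable.tsum_union_disjoint (f := fun s => jump x s)
      (Ioc_disjoint_Ioc_of_le le_rfl) (summable_jump hx 0 a).of_abs (summable_jump hx a b).of_abs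
  have h2 : |∑' s : Ioc a b, jump x s| ≤ (totalVariation x a b).toReal := by
    refine (norm_tsum_le_tsum_norm (f := fun s : Ioc a b => jump x s)
      (by simpa using summable_jump hx a b)).trans ?_
    refine (summable_jump hx a b).tsum_le_of_sum_le fun F => ?_
    have h := sum_abs_jump_le hx hab (F.map (Function.Embedding.subtype _))
      (fun s hs => by
        obtain ⟨r, -, rfl⟩ := Finset.mem_map.1 hs
        exact r.2)
    simpa using h
  have h3 := abs_sub_le_totalVariation hx hab
  have h4 : contPart x b - contPart x a = (x b - x a) - ∑' s : Ioc a b, jump x s := by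
    simp only [contPart, h1]
    ring
  rw [h4]
  exact (abs_sub _ _).trans (by linarith)

theorem isCadlagLFV_contPart {x : ℝ≥0 → ℝ} (hx : IsCadlagLFV x) : IsCadlagLFV (contPart x) := by
  have hbv : LocallyBoundedVariationOn (contPart x) univ := by
    intro a b _ _
    rw [univ_inter]
    refine ne_top_of_le_ne_top (ENNReal.mul_ne_top ENNReal.ofNat_ne_top
      (totalVariation_ne_top hx a b)) (b := 2 * totalVariation x a b) (iSup_le ?_)
    rintro ⟨n, u, hu, hus⟩
    have hle : ∀ i, edist (contPart x (u (i + 1))) (contPart x (u i)) ≤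
        2 * totalVariation x (u i) (u (i + 1)) := fun i => by
      rw [edist_dist, Real.dist_eq]
      have h := ENNReal.ofReal_le_ofReal (abs_contPart_sub_le hx (hu (Nat.le_succ i)))
      rwa [ENNReal.ofReal_mul (by norm_num), ENNReal.ofReal_toReal (totalVariation_ne_top hx _ _),
        ENNReal.ofReal_ofNat] at h
    refine (Finset.sum_le_sum fun i _ => hle i).trans ?_
    rw [← Finset.mul_sum]
    gcongr
    have h := eVariationOn.sum' x (I := u) hu (n := n)
    simp only [totalVariation]
    rw [h]
    exact eVariationOn.mono x (Icc_subset_Icc (hus 0).1 (hus n).2)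
  refine ⟨⟨fun t => ?_, fun t ht => ?_⟩, hbv⟩
  · have h := (tendsto_totalVariation hx t).const_mul 2
    rw [mul_zero] at h
    rw [ContinuousWithinAt, tendsto_iff_dist_tendsto_zero]
    refine squeeze_zero' (Eventually.of_forall fun _ => dist_nonneg) ?_ h
    filter_upwards [self_mem_nhdsWithin] with b hb
    rw [Real.dist_eq]
    exact abs_contPart_sub_le hx hb
  · have hb := hbv 0 t (mem_univ _) (mem_univ _)
    obtain ⟨l, hl⟩ := hb.exists_tendsto_left (x := t)
    refine ⟨l, ?_⟩
    convert hl using 1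
    congr 1
    ext r
    simp only [mem_inter_iff, mem_univ, mem_Icc, mem_Iio, true_and]
    exact ⟨fun h => ⟨⟨zero_le, h.le⟩, h⟩, fun h => h.2⟩

end LevelCrossing

open LevelCrossing

/-!
The number of downcrossings of a level `z` on `[a, b]` is the largest length `numDescents x z a b` of
a chain `p₁ ≤ q₁ ≤ p₂ ≤ ⋯ ≤ qₙ` of times with `x qᵢ < z < x pᵢ` (`toENNReal_downCrossings`): strict
inequalities leave room for an interval of positive width around `z`. In this form it is lower
semicontinuous in `z` and additive in time for all levels except one, and its integral over all
levels is the downward variation (`lintegral_numDescents`). The lower bound is seen on partitions;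
the upper bound follows from Fatou's lemma, because `x` is the limit of step functions along grids
that approach each time from the right, and these have at most as many descents through `z` as steps
that jump over `z`.

For a Borel set `A`, additivity turns the integral over `A` into a measure on times,
`descentMeasure x A`, and those of `A` and its complement add up to `(dx)₋`. If `A` is open, then
near a continuity time `s` with `x s ∈ A` only levels in `A` are crossed, so all of `(dx)₋` there
belongs to `descentMeasure x A`; at a jump time its atom is at least the Lebesgue measure of the
part of `A` jumped over. Hence the occupation measure (image of `(dx^cont)₋` under `x` plus Lebesgue
measure on the intervals jumped over) is at most the integral of the number of downcrossings on open
sets, and on Borel sets by outer regularity. Both have total mass `(dx)₋ (0, t]`, so they are equal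
(`downOccupation_eq`). In particular there is no need to show separately that `(dx^cont)₋` does not
charge the level sets of `x`.

The total masses agree because `(dx)₋` is the sum of `(dx^cont)₋` and the atoms at the negative
jumps. This follows from the minimality of the upward and downward variation among the measures that
dominate the increments (`upVariation_le_measure`), applied once to `x` and once to its continuous
part (`upMeasure_Ioc_decomposition`).

Upcrossings are downcrossings of `-x`, and crossings are the sum of the two. The integral formulas
for `g` come from the equality of measures in one go for the three counts (`occupation_formula`):
`x_{s-}` may replace `x_s` since the jump times are null for the continuous part, and the atoms of
`dx` account for the terms `g (x_{s-})` in the sum over the jumps.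
-/

namespace LevelCrossing

/-! ### Chains of descents through a level -/

section Chains

variable {α β : Type*} [LinearOrder α] [LinearOrder β]

/-- There are points `a ≤ p₁ ≤ q₁ ≤ p₂ ≤ ⋯ ≤ pₙ ≤ qₙ ≤ b` with `f qᵢ < z < f pᵢ` for all `i`. -/
def IsDownChain (f : α → ℝ) (z : ℝ) : ℕ → α → α → Prop
  | 0, a, b => a ≤ b
  | n + 1, a, b => ∃ p q, IsDownChain f z n a p ∧ p ≤ q ∧ q ≤ b ∧ z < f p ∧ f q < z

/-- The largest length of a chain of descents of `f` through the level `z` on `[a, b]`. For a càdlàg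
function on `[0, ∞)` this is the number of downcrossings of `z`, see `toENNReal_downCrossings`. -/
noncomputable def numDescents (f : α → ℝ) (z : ℝ) (a b : α) : ℝ≥0∞ :=
  ⨆ (n : ℕ) (_ : IsDownChain f z n a b), (n : ℝ≥0∞)

variable {f : α → ℝ} {z : ℝ} {n m : ℕ} {a b c : α}

theorem IsDownChain.le (h : IsDownChain f z n a b) : a ≤ b := by
  induction n generalizing b with
  | zero => exact h
  | succ n ih =>
    obtain ⟨p, q, h, hpq, hq, -⟩ := h
    exact (ih h).trans (hpq.trans hq)

theorem IsDownChain.mono_right (h : IsDownChain f z n a b) (hbc : b ≤ c) :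
    IsDownChain f z n a c := by
  cases n with
  | zero => exact le_trans h hbc
  | succ n =>
    obtain ⟨p, q, h, hpq, hq, h'⟩ := h
    exact ⟨p, q, h, hpq, hq.trans hbc, h'⟩

theorem IsDownChain.append (h : IsDownChain f z n a b) (h' : IsDownChain f z m b c) :
    IsDownChain f z (n + m) a c := by
  induction m generalizing c with
  | zero => exact h.mono_right h'
  | succ m ih =>
    obtain ⟨p, q, h', hr⟩ := h'
    exact ⟨p, q, ih h', hr⟩

/-- A time `b` with `f b ≠ z` splits a chain without loss: if `b` lies inside a descent, it can
replace one end of that descent. -/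
theorem IsDownChain.split (h : IsDownChain f z n a c) (hab : a ≤ b) (hbc : b ≤ c) (hb : f b ≠ z) :
    ∃ k l, k + l = n ∧ IsDownChain f z k a b ∧ IsDownChain f z l b c := by
  induction n generalizing c with
  | zero => exact ⟨0, 0, rfl, hab, hbc⟩
  | succ n ih =>
    obtain ⟨p, q, h, hpq, hq, hp', hq'⟩ := h
    rcases le_total b p with hbp | hpb
    · obtain ⟨k, l, hkl, hk, hl⟩ := ih h hbp
      exact ⟨k, l + 1, by omega, hk, p, q, hl, hpq, hq, hp', hq'⟩
    · rcases le_total q b with hqb | hbq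
      · exact ⟨n + 1, 0, rfl, ⟨p, q, h, hpq, hqb, hp', hq'⟩, hbc⟩
      · rcases lt_or_gt_of_ne hb with hb | hb
        · exact ⟨n + 1, 0, rfl, ⟨p, b, h, hpb, le_rfl, hp', hb⟩, hbc⟩
        · exact ⟨n, 1, rfl, h.mono_right hpb, b, q, le_refl b, hbq, hq, hb, hq'⟩

theorem isOpen_isDownChain (f : α → ℝ) (n : ℕ) (a b : α) : IsOpen {z | IsDownChain f z n a b} := by
  induction n generalizing b with
  | zero => exact isOpen_const
  | succ n ih =>
    have : {z | IsDownChain f z (n + 1) a b} = ⋃ (p : α) (q : α),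
        {z | IsDownChain f z n a p} ∩ {_z | p ≤ q ∧ q ≤ b} ∩ (Iio (f p) ∩ Ioi (f q)) := by
      ext z
      simp only [IsDownChain, mem_ofPred_eq, mem_iUnion, mem_inter_iff, mem_Iio, mem_Ioi]
      exact ⟨fun ⟨p, q, h1, h2, h3, h4, h5⟩ => ⟨p, q, ⟨h1, h2, h3⟩, h4, h5⟩,
        fun ⟨p, q, ⟨h1, h2, h3⟩, h4, h5⟩ => ⟨p, q, h1, h2, h3, h4, h5⟩⟩
    rw [this]
    exact isOpen_iUnion fun p => isOpen_iUnion fun q =>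
      ((ih p).inter isOpen_const).inter (isOpen_Iio.inter isOpen_Ioi)

theorem measurable_numDescents (f : α → ℝ) (a b : α) : Measurable fun z => numDescents f z a b := by
  have h : (fun z => numDescents f z a b) =
      fun z => ⨆ n : ℕ, {z | IsDownChain f z n a b}.indicator (fun _ => (n : ℝ≥0∞)) z := by
    funext z
    refine iSup_congr fun n => ?_
    by_cases hz : IsDownChain f z n a b <;> simp [hz]
  rw [h]
  exact Measurable.iSup fun n => measurable_const.indicator (isOpen_isDownChain f n a b).measurableSet

theorem IsDownChain.le_numDescents (h : IsDownChain f z n a b) : (n : ℝ≥0∞) ≤ numDescents f z a b :=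
  le_iSup₂ (f := fun (n : ℕ) (_ : IsDownChain f z n a b) => (n : ℝ≥0∞)) n h

theorem numDescents_add_le (hab : a ≤ b) (hbc : b ≤ c) :
    numDescents f z a b + numDescents f z b c ≤ numDescents f z a c :=
  ENNReal.biSup_add_biSup_le (s := {n | IsDownChain f z n a b}) (t := {n | IsDownChain f z n b c})
    ⟨0, hab⟩ ⟨0, hbc⟩ fun n hn m hm => by
      simpa using (IsDownChain.append hn hm).le_numDescents

theorem numDescents_add (hab : a ≤ b) (hbc : b ≤ c) (hb : f b ≠ z) :
    numDescents f z a b + numDescents f z b c = numDescents f z a c := by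
  refine (numDescents_add_le hab hbc).antisymm (iSup₂_le fun n hn => ?_)
  obtain ⟨k, l, rfl, hk, hl⟩ := hn.split hab hbc hb
  push_cast
  exact add_le_add hk.le_numDescents hl.le_numDescents

theorem one_le_numDescents (hab : a ≤ b) (ha : z < f a) (hb : f b < z) :
    1 ≤ numDescents f z a b := by
  have : IsDownChain f z 1 a b := ⟨a, b, le_refl a, hab, le_rfl, ha, hb⟩
  simpa using this.le_numDescents

theorem numDescents_eq_zero (h : (∀ r ∈ Icc a b, f r ≤ z) ∨ ∀ r ∈ Icc a b, z ≤ f r) :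
    numDescents f z a b = 0 := by
  refine le_antisymm (iSup₂_le fun n hn => ?_) zero_le
  cases n with
  | zero => simp
  | succ n =>
    obtain ⟨p, q, hn, hpq, hq, hp', hq'⟩ := hn
    rcases h with h | h
    · exact absurd (h p ⟨hn.le, hpq.trans hq⟩) (not_le.2 hp')
    · exact absurd (h q ⟨hn.le.trans hpq, hq⟩) (not_le.2 hq')

theorem IsDownChain.of_comp {π : β → α} (hπ : Monotone π) {a b : β}
    (h : IsDownChain (f ∘ π) z n a b) : IsDownChain f z n (π a) (π b) := by
  induction n generalizing b with
  | zero => exact hπ h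
  | succ n ih =>
    obtain ⟨p, q, h, hpq, hq, h'⟩ := h
    exact ⟨π p, π q, ih h, hπ hpq, hπ hq, h'⟩

/-- A finite sequence descends through `z` in at most as many steps as those of its steps that
jump from above `z` to `z` or below. -/
theorem IsDownChain.le_sum {f : ℕ → ℝ} {a b : ℕ} (h : IsDownChain f z n a b) :
    (n : ℝ≥0∞) ≤ ∑ i ∈ Finset.Ico a b, (Ico (f (i + 1)) (f i)).indicator 1 z := by
  induction n generalizing b with
  | zero => simp
  | succ n ih =>
    obtain ⟨p, q, h, hpq, hq, hp', hq'⟩ := h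
    rw [← Finset.sum_Ico_consecutive _ h.le (hpq.trans hq)]
    push_cast
    refine add_le_add (ih h) ?_
    rw [← Finset.sum_Ico_consecutive _ hpq hq]
    refine le_add_right ?_
    suffices H : ∃ i ∈ Finset.Ico p q, z ∈ Ico (f (i + 1)) (f i) by
      obtain ⟨i, hi, hz⟩ := H
      have h1 := Finset.single_le_sum (s := Finset.Ico p q)
        (f := fun i => (Ico (f (i + 1)) (f i)).indicator (1 : ℝ → ℝ≥0∞) z)
        (fun _ _ => zero_le) hi
      simpa only [indicator_of_mem hz, Pi.one_apply] using h1
    by_contra hcon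
    push Not at hcon
    have key : ∀ k, p + k ≤ q → z < f (p + k) := by
      intro k
      induction k with
      | zero => exact fun _ => hp'
      | succ k ihk =>
        intro hk
        have h1 := hcon (p + k) (Finset.mem_Ico.2 ⟨by omega, by omega⟩)
        have h2 := ihk (by omega)
        by_contra h3
        exact h1 ⟨not_lt.1 h3, h2⟩
    have := key (q - p) (by omega)
    rw [show p + (q - p) = q by omega] at this
    exact lt_asymm this hq'

end Chains

/-! ### The crossing times of intervals -/

/-- The infimum of a set of times defined by a condition on a right-continuous function is attained
up to closure of the condition. -/
theorem exists_sInf_eq {x : ℝ≥0 → ℝ} (hx : ∀ t, ContinuousWithinAt x (Ici t) t) {P : ℝ → Prop}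
    {K : Set ℝ} (hK : IsClosed K) (hP : ∀ v, P v → v ∈ K) {a : ℝ≥0∞} {t : ℝ≥0}
    (h : sInf {u : ℝ≥0∞ | ∃ r : ℝ≥0, u = r ∧ a ≤ r ∧ r ≤ t ∧ P (x r)} ≤ t) :
    ∃ r : ℝ≥0, sInf {u : ℝ≥0∞ | ∃ r : ℝ≥0, u = r ∧ a ≤ r ∧ r ≤ t ∧ P (x r)} = r ∧
      a ≤ r ∧ r ≤ t ∧ x r ∈ K := by
  set S := {u : ℝ≥0∞ | ∃ r : ℝ≥0, u = r ∧ a ≤ r ∧ r ≤ t ∧ P (x r)} with hS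
  set T := {r : ℝ≥0 | a ≤ r ∧ r ≤ t ∧ P (x r)} with hT
  have hST : S = (fun r : ℝ≥0 => (r : ℝ≥0∞)) '' T := by
    ext u
    simp only [hS, hT, mem_ofPred_eq, mem_image]
    exact ⟨fun ⟨r, h1, h2⟩ => ⟨r, h2, h1.symm⟩, fun ⟨r, h2, h1⟩ => ⟨r, h1.symm, h2⟩⟩
  have hne : T.Nonempty := by
    by_contra hcon
    rw [not_nonempty_iff_eq_empty.1 hcon, image_empty] at hST
    rw [hST, sInf_empty] at h
    exact absurd h (by simp)
  have hglb : IsGLB T (sInf T) := isGLB_csInf hne (OrderBot.bddBelow T)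
  have hcoe : sInf S = (sInf T : ℝ≥0) := by
    rw [hST, ENNReal.coe_sInf hne, sInf_image]
  refine ⟨sInf T, hcoe, ?_, ?_, ?_⟩
  · rw [← hcoe, hST, sInf_image]
    exact le_iInf₂ fun r hr => hr.1
  · obtain ⟨r, hr⟩ := hne
    exact (hglb.1 hr).trans hr.2.1
  · have h1 : ∃ᶠ r in 𝓝[≥] (sInf T), x r ∈ K :=
      (hglb.frequently_mem hne).mono fun r hr => hP _ hr.2.2
    exact hK.mem_of_frequently_of_tendsto h1 (hx (sInf T))

/-- The times at which the descents of the interval begin and end form a chain. The end points satisfy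
only `x ≤ y - c / 2`, by right continuity, which is below `y` as `c > 0`. -/
theorem isDownChain_of_downTime_le {x : ℝ≥0 → ℝ} (hx : ∀ t, ContinuousWithinAt x (Ici t) t)
    {s t : ℝ≥0} {y c : ℝ} (hc : 0 < c) {n : ℕ} (h : downTime x s t y c n ≤ t) :
    ∃ r : ℝ≥0, downTime x s t y c n = r ∧ r ≤ t ∧ IsDownChain x y n s r := by
  induction n with
  | zero => exact ⟨s, rfl, by simpa [downTime] using h, le_refl s⟩
  | succ n ih =>
    obtain ⟨q, hq, haq, hqt, hxq⟩ := exists_sInf_eq hx (P := fun v => v < y - c / 2)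
      (isClosed_Iic (a := y - c / 2)) (fun v hv => hv.le) h
    obtain ⟨p, hp, hap, hpt, hxp⟩ := exists_sInf_eq hx (P := fun v => y + c / 2 ≤ v)
      (isClosed_Ici (a := y + c / 2)) (fun v hv => hv) (a := downTime x s t y c n) (t := t)
      (haq.trans (by exact_mod_cast hqt))
    obtain ⟨r, hr, hrt, hch⟩ := ih (hap.trans (by exact_mod_cast hpt))
    rw [mem_Iic] at hxq
    rw [mem_Ici] at hxp
    refine ⟨q, hq, hqt, p, q, hch.mono_right ?_, ?_, le_rfl, by linarith, by linarith⟩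
    · rw [hr] at hap
      exact_mod_cast hap
    · have : firstAbove x t y c (downTime x s t y c n) = p := hp
      rw [this] at haq
      exact_mod_cast haq

/-- A finite chain stays at some positive distance `c / 2` from the level, and the crossing times of
the interval of that width occur no later than those of the chain. -/
theorem exists_downTime_le_of_isDownChain {x : ℝ≥0 → ℝ} {s t b : ℝ≥0} {y : ℝ} {n : ℕ}
    (h : IsDownChain x y n s b) (hb : b ≤ t) : ∃ c > 0, downTime x s t y c n ≤ b := by
  induction n generalizing b with
  | zero =>
    refine ⟨1, one_pos, ?_⟩
    have : s ≤ b := h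
    simpa [downTime] using this
  | succ n ih =>
    obtain ⟨p, q, h, hpq, hqb, hp, hq⟩ := h
    obtain ⟨c, hc, hcn⟩ := ih h (hpq.trans (hqb.trans hb))
    refine ⟨min c (min (x p - y) (y - x q)),
      lt_min hc (lt_min (sub_pos.2 hp) (sub_pos.2 hq)), ?_⟩
    set c' := min c (min (x p - y) (y - x q)) with hc'
    have h0 : 0 < c' := lt_min hc (lt_min (sub_pos.2 hp) (sub_pos.2 hq))
    have h1 : c' ≤ x p - y := (min_le_right _ _).trans (min_le_left _ _)
    have h2 : c' ≤ y - x q := (min_le_right _ _).trans (min_le_right _ _)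
    have h3 : firstAbove x t y c' (downTime x s t y c' n) ≤ p :=
      sInf_le ⟨p, rfl, (downTime_mono x s t y (min_le_left _ _) n).trans hcn,
        hpq.trans (hqb.trans hb), by linarith⟩
    have h4 : downTime x s t y c' (n + 1) ≤ q :=
      sInf_le ⟨q, rfl, h3.trans (by exact_mod_cast hpq), hqb.trans hb, by linarith⟩
    exact h4.trans (by exact_mod_cast hqb)

/-- The number of downcrossings of a level is the largest length of a chain of strict descents
through it. -/
theorem toENNReal_downCrossings {x : ℝ≥0 → ℝ} (hx : ∀ t, ContinuousWithinAt x (Ici t) t)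
    (s t : ℝ≥0) (y : ℝ) : ((downCrossings x s t y : ℕ∞) : ℝ≥0∞) = numDescents x y s t := by
  have h : downCrossings x s t y = ⨆ c ∈ Ioi (0 : ℝ), downCrossingsIntv x s t y c := by
    rw [← sSup_image]
    exact tendsto_nhds_unique (tendsto_downCrossings x s t y)
      ((antitone_downCrossingsIntv x s t y).tendsto_nhdsGT 0)
  rw [h]
  simp only [downCrossingsIntv, ENat.toENNReal_iSup, ENat.toENNReal_coe, numDescents]
  apply le_antisymm
  · refine iSup₂_le fun c hc => iSup₂_le fun n hn => ?_
    obtain ⟨r, -, hrt, hch⟩ := isDownChain_of_downTime_le hx hc hn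
    exact (hch.mono_right hrt).le_numDescents
  · refine iSup₂_le fun n hn => ?_
    obtain ⟨c, hc, hcn⟩ := exists_downTime_le_of_isDownChain hn le_rfl
    exact le_iSup₂_of_le c hc (le_iSup₂_of_le n hcn le_rfl)

/-! ### The integral of the number of downcrossings -/

/-- Fatou's lemma for the step functions that approximate `x` from the right on a dyadic grid. -/
theorem lintegral_numDescents_le_downVariation {x : ℝ≥0 → ℝ}
    (hx : ∀ t, ContinuousWithinAt x (Ici t) t) {a b : ℝ≥0} (hab : a ≤ b) :
    ∫⁻ z, numDescents x z a b ≤ downVariation x a b := by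
  -- `x ∘ u k ∘ ι k` converges to `x` on `[a, b]`, and takes values along the partition `u k`
  let ι : ℕ → ℝ≥0 → ℕ := fun k s => ⌈s * (k + 1)⌉₊
  let u : ℕ → ℕ → ℝ≥0 := fun k j => max a (min b (j / (k + 1)))
  have hι : ∀ k, Monotone (ι k) := fun k p q hpq => by
    dsimp only [ι]
    gcongr
  have hu : ∀ k, Monotone (u k) := fun k p q hpq => by
    dsimp only [u]
    gcongr
  have hlim : ∀ s ∈ Icc a b, Tendsto (fun k => x (u k (ι k s))) atTop (𝓝 (x s)) := by
    intro s hs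
    have hge : ∀ k, s ≤ u k (ι k s) := fun k => by
      refine le_max_of_le_right (le_min hs.2 ?_)
      rw [le_div_iff₀ (by positivity)]
      exact Nat.le_ceil _
    have hle : ∀ k, u k (ι k s) ≤ s + 1 / ((k : ℝ≥0) + 1) := fun k => by
      refine max_le (hs.1.trans le_self_add) (min_le_of_right_le ?_)
      rw [div_le_iff₀ (by positivity), add_mul, one_div, inv_mul_cancel₀ (by positivity)]
      exact (Nat.ceil_lt_add_one zero_le).le
    have hto : Tendsto (fun k => u k (ι k s)) atTop (𝓝 s) := by
      refine tendsto_of_tendsto_of_tendsto_of_le_of_le tendsto_const_nhds ?_ hge hle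
      have h1 : Tendsto (fun k : ℕ => 1 / ((k : ℝ≥0) + 1)) atTop (𝓝 0) :=
        tendsto_one_div_add_atTop_nhds_zero_nat
      simpa using h1.const_add s
    exact (hx s).tendsto.comp
      (tendsto_nhdsWithin_iff.2 ⟨hto, Eventually.of_forall hge⟩)
  let N : ℕ → ℝ → ℝ≥0∞ := fun k z =>
    ∑ i ∈ Finset.Ico (ι k a) (ι k b), (Ico (x (u k (i + 1))) (x (u k i))).indicator 1 z
  have hN : ∀ k, Measurable (N k) := fun k =>
    Finset.measurable_fun_sum _ fun i _ => measurable_one.indicator measurableSet_Ico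
  have hev : ∀ z n (p : ℝ≥0), p ≤ b → IsDownChain x z n a p →
      ∀ᶠ k in atTop, IsDownChain (x ∘ u k ∘ ι k) z n a p := by
    intro z n
    induction n with
    | zero => exact fun p _ h => Eventually.of_forall fun k => h
    | succ n ih =>
      rintro r hr ⟨p, q, h, hpq, hq, hp', hq'⟩
      have hqb := hq.trans hr
      filter_upwards [ih p (hpq.trans hqb) h,
        (hlim p ⟨h.le, hpq.trans hqb⟩).eventually_const_lt hp',
        (hlim q ⟨h.le.trans hpq, hqb⟩).eventually_lt_const hq'] with k h1 h2 h3
      exact ⟨p, q, h1, hpq, hq, h2, h3⟩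
  calc ∫⁻ z, numDescents x z a b ≤ ∫⁻ z, liminf (fun k => N k z) atTop := by
        refine lintegral_mono fun z => iSup₂_le fun n hn => ?_
        refine le_liminf_of_le (by isBoundedDefault) ?_
        filter_upwards [hev z n b le_rfl hn] with k hk
        exact (IsDownChain.of_comp (f := x ∘ u k) (hι k) hk).le_sum
    _ ≤ liminf (fun k => ∫⁻ z, N k z) atTop := lintegral_liminf_le hN
    _ ≤ downVariation x a b := by
        refine liminf_le_of_le (by isBoundedDefault) fun v hv => ?_
        obtain ⟨k, hk⟩ := hv.exists
        refine hk.trans ?_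
        rw [lintegral_finsetSum _ fun i _ => measurable_one.indicator measurableSet_Ico]
        simp only [lintegral_indicator_one measurableSet_Ico, Real.volume_Ico]
        have h0 : u k 0 = a := by simp [u]
        have hb : u k (ι k b) = b := by
          have h1 : b ≤ (ι k b : ℝ≥0) / (k + 1) := by
            rw [le_div_iff₀ (by positivity)]
            exact Nat.le_ceil _
          simp only [u, min_eq_left h1, max_eq_right hab]
        have hsub : Finset.Ico (ι k a) (ι k b) ⊆ Finset.range (ι k b) := by
          rw [Finset.range_eq_Ico]
          exact Finset.Ico_subset_Ico_left (Nat.zero_le _)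
        refine (Finset.sum_le_sum_of_subset hsub).trans ?_
        simp only [← neg_sub (x (u k (_ + 1))) (x (u k _))]
        exact le_iSup_of_le (ι k b) (le_iSup_of_le (u k) (le_iSup_of_le (hu k)
          (le_iSup_of_le h0 (le_iSup_of_le hb le_rfl))))

/-- The reverse inequality, tested on a partition. -/
theorem sum_le_lintegral_numDescents (x : ℝ≥0 → ℝ) {u : ℕ → ℝ≥0} (hu : Monotone u) (n : ℕ) :
    ∑ i ∈ Finset.range n, ENNReal.ofReal (-(x (u (i + 1)) - x (u i))) ≤
      ∫⁻ z, numDescents x z (u 0) (u n) := by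
  induction n with
  | zero => simp
  | succ n ih =>
    rw [Finset.sum_range_succ]
    refine (add_le_add ih ?_).trans ((lintegral_add_left (measurable_numDescents _ _ _) _).ge.trans
      (lintegral_mono fun z => numDescents_add_le (hu (Nat.zero_le n)) (hu (Nat.le_succ n))))
    rw [neg_sub, ← Real.volume_Ioo, ← lintegral_indicator_one measurableSet_Ioo]
    refine lintegral_mono (indicator_le fun z hz => ?_)
    exact one_le_numDescents (hu (Nat.le_succ n)) hz.2 hz.1

theorem lintegral_numDescents {x : ℝ≥0 → ℝ} (hx : ∀ t, ContinuousWithinAt x (Ici t) t)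
    {a b : ℝ≥0} (hab : a ≤ b) : ∫⁻ z, numDescents x z a b = downVariation x a b := by
  refine (lintegral_numDescents_le_downVariation hx hab).antisymm ?_
  refine iSup_le fun n => iSup_le fun u => iSup_le fun hu => iSup_le fun h0 => iSup_le fun hn => ?_
  rw [← h0, ← hn]
  exact sum_le_lintegral_numDescents x hu n

/-! ### Measures on the half-line -/

/-- Measures on the half-line that are finite on bounded intervals are determined by their values on
the intervals `(a, b]` and on `{0}`, which no such interval contains. -/
theorem ext_of_Ioc_of_singleton_zero {μ ν : Measure ℝ≥0} (h0 : μ {0} = ν {0})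
    (h : ∀ a b, a < b → μ (Ioc a b) = ν (Ioc a b)) (hfin0 : μ {0} ≠ ∞)
    (hfin : ∀ a b, μ (Ioc a b) ≠ ∞) : μ = ν := by
  have hIic : ∀ (ρ : Measure ℝ≥0) (a : ℝ≥0), ρ (Iic a) = ρ {0} + ρ (Ioc 0 a) := fun ρ a => by
    rw [← measure_union (by simp) measurableSet_Ioc]
    congr 1
    ext r
    rcases eq_or_ne r 0 with rfl | hr <;> simp
  refine Measure.ext_of_generateFrom_of_iUnion (range Iic) (fun n : ℕ => Iic (n : ℝ≥0))
    (by rw [← borel_eq_generateFrom_Iic]; exact BorelSpace.measurable_eq) isPiSystem_Iic ?_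
    (fun n => mem_range_self _) (fun n => ?_) ?_
  · refine eq_univ_of_forall fun r => ?_
    obtain ⟨n, hn⟩ := exists_nat_ge r
    exact mem_iUnion.2 ⟨n, hn⟩
  · rw [hIic]
    exact ENNReal.add_ne_top.2 ⟨hfin0, hfin _ _⟩
  · rintro _ ⟨a, rfl⟩
    rw [hIic, hIic, h0]
    rcases (zero_le (a := a)).eq_or_lt with rfl | ha
    · simp
    · rw [h 0 a ha]

theorem tendsto_measure_Ioc_singleton {μ : Measure ℝ≥0} {s : ℝ≥0} (hfin : ∀ a, μ (Ioc a s) ≠ ∞)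
    {u : ℕ → ℝ≥0} (hu : StrictMono u) (hus : ∀ n, u n < s) (hlim : Tendsto u atTop (𝓝 s)) :
    Tendsto (fun n => μ (Ioc (u n) s)) atTop (𝓝 (μ {s})) := by
  have h : ⋂ n, Ioc (u n) s = {s} := by
    ext r
    simp only [mem_iInter, mem_Ioc, mem_singleton_iff]
    exact ⟨fun h => le_antisymm (h 0).2 (le_of_tendsto hlim (Eventually.of_forall fun n => (h n).1.le)),
      fun h n => ⟨h ▸ hus n, h.le⟩⟩
  rw [← h]
  exact tendsto_measure_iInter_atTop (fun n => measurableSet_Ioc.nullMeasurableSet)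
    (fun m n hmn => Ioc_subset_Ioc_left (hu.monotone hmn)) ⟨0, hfin _⟩

theorem hasSum_measure_singleton {μ : Measure ℝ≥0} {K : Set ℝ≥0} (hK : K.Countable)
    (hfin : μ K ≠ ∞) : HasSum (fun s : K => (μ {(s : ℝ≥0)}).toReal) (μ K).toReal := by
  have h : ∑' s : K, μ {(s : ℝ≥0)} = μ K := by
    simpa using tsum_measure_preimage_singleton (μ := μ) hK (f := id) fun s _ =>
      measurableSet_singleton s
  rw [← h] at hfin ⊢
  rw [ENNReal.tsum_toReal_eq fun s => ENNReal.ne_top_of_tsum_ne_top hfin s]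
  exact ENNReal.hasSum_toReal hfin

/-! ### The variation measures -/

variable {x : ℝ≥0 → ℝ}

theorem downMeasure_eq (x : ℝ≥0 → ℝ) : downMeasure x = upMeasure fun s => -x s := by
  rw [downMeasure, upMeasure]
  congr 1
  funext a b
  exact downVariation_eq x a b

theorem upMeasure_Ioc (hx : IsCadlagLFV x) {a b : ℝ≥0} (hab : a ≤ b) :
    upMeasure x (Ioc a b) = ENNReal.ofReal (((totalVariation x a b).toReal + (x b - x a)) / 2) := by
  rcases hab.eq_or_lt with rfl | h
  · simp [totalVariation, eVariationOn.subsingleton]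
  · rw [(isMeasureOf_upMeasure hx).2 a b h, upVariation_eq hx hab]

theorem totalVariation_neg (x : ℝ≥0 → ℝ) (a b : ℝ≥0) :
    totalVariation (fun s => -x s) a b = totalVariation x a b := by
  simp [totalVariation, eVariationOn, edist_neg_neg]

theorem downMeasure_Ioc (hx : IsCadlagLFV x) {a b : ℝ≥0} (hab : a ≤ b) :
    downMeasure x (Ioc a b) =
      ENNReal.ofReal (((totalVariation x a b).toReal - (x b - x a)) / 2) := by
  rw [downMeasure_eq, upMeasure_Ioc hx.neg hab, totalVariation_neg]
  congr 2
  ring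

theorem upMeasure_Ioc_ne_top (hx : IsCadlagLFV x) (a b : ℝ≥0) : upMeasure x (Ioc a b) ≠ ∞ := by
  rcases le_total a b with h | h
  · rw [upMeasure_Ioc hx h]
    exact ENNReal.ofReal_ne_top
  · simp [Ioc_eq_empty (not_lt.2 h)]

theorem downMeasure_Ioc_ne_top (hx : IsCadlagLFV x) (a b : ℝ≥0) : downMeasure x (Ioc a b) ≠ ∞ := by
  rw [downMeasure_eq]
  exact upMeasure_Ioc_ne_top hx.neg a b

theorem toReal_upMeasure_sub (hx : IsCadlagLFV x) {a b : ℝ≥0} (hab : a ≤ b) :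
    (upMeasure x (Ioc a b)).toReal - (downMeasure x (Ioc a b)).toReal = x b - x a := by
  have h := abs_le.1 (abs_sub_le_totalVariation hx hab)
  rw [upMeasure_Ioc hx hab, downMeasure_Ioc hx hab, ENNReal.toReal_ofReal (by linarith),
    ENNReal.toReal_ofReal (by linarith)]
  ring

theorem variationMeasure_eq (hx : IsCadlagLFV x) :
    variationMeasure x = upMeasure x + downMeasure x := by
  have hv := isMeasureOf_variationMeasure hx
  refine (ext_of_Ioc_of_singleton_zero ?_ (fun a b hab => ?_) ?_ fun a b => ?_).symm
  · simp [(isMeasureOf_upMeasure hx).1, (isMeasureOf_downMeasure hx).1, hv.1]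
  · have h := abs_le.1 (abs_sub_le_totalVariation hx hab.le)
    rw [hv.2 a b hab, Measure.add_apply, upMeasure_Ioc hx hab.le, downMeasure_Ioc hx hab.le,
      ← ENNReal.ofReal_add (by linarith) (by linarith)]
    convert ENNReal.ofReal_toReal (totalVariation_ne_top hx a b) using 2
    ring
  · simp [(isMeasureOf_upMeasure hx).1, (isMeasureOf_downMeasure hx).1]
  · rw [Measure.add_apply]
    exact ENNReal.add_ne_top.2 ⟨upMeasure_Ioc_ne_top hx a b, downMeasure_Ioc_ne_top hx a b⟩

theorem variationMeasure_Ioc_ne_top (hx : IsCadlagLFV x) (a b : ℝ≥0) :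
    variationMeasure x (Ioc a b) ≠ ∞ := by
  rw [variationMeasure_eq hx, Measure.add_apply]
  exact ENNReal.add_ne_top.2 ⟨upMeasure_Ioc_ne_top hx a b, downMeasure_Ioc_ne_top hx a b⟩

/-- Minimality of the upward variation: it is below every measure that dominates the increments. -/
theorem upVariation_le_measure {p : Measure ℝ≥0}
    (h : ∀ a b, a ≤ b → ENNReal.ofReal (x b - x a) ≤ p (Ioc a b)) (a b : ℝ≥0) :
    upVariation x a b ≤ p (Ioc a b) := by
  refine iSup_le fun n => iSup_le fun u => iSup_le fun hu => iSup_le fun h0 => iSup_le fun hn => ?_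
  rw [← h0, ← hn]
  clear h0 hn
  induction n with
  | zero => simp
  | succ n ih =>
    rw [Finset.sum_range_succ, ← Ioc_union_Ioc_eq_Ioc (hu (Nat.zero_le n)) (hu (Nat.le_succ n)),
      measure_union (Ioc_disjoint_Ioc_of_le le_rfl) measurableSet_Ioc]
    exact add_le_add ih (h _ _ (hu (Nat.le_succ n)))

/-! ### Jumps -/

theorem IsCadlag.tendsto_leftLim (hx : IsCadlag x) {s : ℝ≥0} (hs : 0 < s) :
    Tendsto x (𝓝[<] s) (𝓝 (Function.leftLim x s)) := by
  have hne : (𝓝[<] s).NeBot := nhdsLT_neBot_of_exists_lt ⟨0, hs⟩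
  obtain ⟨l, hl⟩ := hx.2 s hs
  rwa [leftLim_eq_of_tendsto hl]

theorem leftLim_zero (x : ℝ≥0 → ℝ) : Function.leftLim x 0 = x 0 :=
  leftLim_eq_of_isBot fun _ => zero_le

theorem jump_zero (x : ℝ≥0 → ℝ) : jump x 0 = 0 := by
  rw [jump, leftLim_zero, sub_self]

theorem leftLim_neg (hx : IsCadlag x) (s : ℝ≥0) :
    Function.leftLim (fun r => -x r) s = -Function.leftLim x s := by
  rcases (zero_le (a := s)).eq_or_lt with rfl | hs
  · simp only [leftLim_zero]
  · have hne : (𝓝[<] s).NeBot := nhdsLT_neBot_of_exists_lt ⟨0, hs⟩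
    exact leftLim_eq_of_tendsto (hx.tendsto_leftLim hs).neg

theorem jump_neg (hx : IsCadlag x) (s : ℝ≥0) : jump (fun r => -x r) s = -jump x s := by
  rw [jump, jump, leftLim_neg hx]
  ring

theorem contPart_neg (hx : IsCadlag x) : contPart (fun r => -x r) = fun r => -contPart x r := by
  funext s
  simp only [contPart, jump_neg hx, tsum_neg]
  ring

theorem IsCadlag.continuousAt (hx : IsCadlag x) {s : ℝ≥0} (hs : jump x s = 0) :
    ContinuousAt x s := by
  rcases (zero_le (a := s)).eq_or_lt with rfl | h0
  · have h := hx.1 0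
    have hu : Ici (0 : ℝ≥0) = univ := eq_univ_of_forall fun r => zero_le (a := r)
    rwa [hu, continuousWithinAt_univ] at h
  · have h := hx.tendsto_leftLim h0
    rw [← sub_eq_zero.1 hs] at h
    exact continuousAt_iff_continuous_left_right.2
      ⟨continuousWithinAt_Iio_iff_Iic.1 h, hx.1 s⟩

/-- The times at which `x` jumps. -/
def jumpTimes (x : ℝ≥0 → ℝ) : Set ℝ≥0 := {s | jump x s ≠ 0}

theorem countable_jumpTimes (hx : IsCadlagLFV x) : (jumpTimes x).Countable := by
  have h : jumpTimes x ⊆ ⋃ n : ℕ, (fun s : Ioc 0 (n : ℝ≥0) => (s : ℝ≥0)) ''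
      Function.support (fun s : Ioc 0 (n : ℝ≥0) => |jump x s|) := by
    intro s hs
    obtain ⟨n, hn⟩ := exists_nat_ge s
    have h0 : 0 < s := by
      rw [pos_iff_ne_zero]
      rintro rfl
      exact hs (jump_zero x)
    exact mem_iUnion.2 ⟨n, ⟨s, h0, hn⟩, abs_ne_zero.2 hs, rfl⟩
  refine (countable_iUnion fun n : ℕ => ?_).mono h
  exact (summable_jump hx 0 n).countable_support.image _

theorem contPart_sub (hx : IsCadlagLFV x) {a b : ℝ≥0} (hab : a ≤ b) :
    contPart x b - contPart x a = (x b - x a) - ∑' s : Ioc a b, jump x s := by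
  have h1 : ∑' s : Ioc 0 b, jump x s = (∑' s : Ioc 0 a, jump x s) + ∑' s : Ioc a b, jump x s := by
    rw [← Ioc_union_Ioc_eq_Ioc (zero_le (a := a)) hab]
    exact Summable.tsum_union_disjoint (f := fun s => jump x s)
      (Ioc_disjoint_Ioc_of_le le_rfl) (summable_jump hx 0 a).of_abs (summable_jump hx a b).of_abs
  simp only [contPart, h1]
  ring

/-- The jump is the difference of the atoms of `(dx)₊` and `(dx)₋`. -/
theorem jump_eq_measure_sub (hx : IsCadlagLFV x) (s : ℝ≥0) :
    jump x s = (upMeasure x {s}).toReal - (downMeasure x {s}).toReal := by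
  rcases (zero_le (a := s)).eq_or_lt with rfl | hs
  · simp [jump_zero, (isMeasureOf_upMeasure hx).1, (isMeasureOf_downMeasure hx).1]
  obtain ⟨u, hu, hus, hlim⟩ := exists_seq_strictMono_tendsto' hs
  have key : ∀ {μ : Measure ℝ≥0}, (∀ a b, μ (Ioc a b) ≠ ∞) →
      Tendsto (fun n => (μ (Ioc (u n) s)).toReal) atTop (𝓝 (μ {s}).toReal) := fun {μ} hμ =>
    (ENNReal.tendsto_toReal (ne_top_of_le_ne_top (hμ 0 s) (measure_mono (by simpa using hs)))).comp
      (tendsto_measure_Ioc_singleton (fun a => hμ a s) hu (fun n => (hus n).2) hlim)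
  have h1 := (key (upMeasure_Ioc_ne_top hx)).sub (key (downMeasure_Ioc_ne_top hx))
  have h2 : Tendsto (fun n => x s - x (u n)) atTop (𝓝 (jump x s)) :=
    ((hx.cadlag.tendsto_leftLim hs).comp (tendsto_nhdsWithin_iff.2
      ⟨hlim, Eventually.of_forall fun n => (hus n).2⟩)).const_sub (x s)
  refine tendsto_nhds_unique h2 (h1.congr fun n => ?_)
  exact toReal_upMeasure_sub hx (hus n).2.le

/-- The purely atomic measure that gives each time of a positive jump the size of the jump. -/
noncomputable def upJumpMeasure (x : ℝ≥0 → ℝ) : Measure ℝ≥0 :=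
  Measure.sum fun s => ENNReal.ofReal (jump x s) • Measure.dirac s

theorem upJumpMeasure_apply (x : ℝ≥0 → ℝ) {B : Set ℝ≥0} (hB : MeasurableSet B) :
    upJumpMeasure x B = ∑' s : B, ENNReal.ofReal (jump x s) := by
  rw [upJumpMeasure, Measure.sum_apply _ hB, tsum_subtype B fun s => ENNReal.ofReal (jump x s)]
  refine tsum_congr fun s => ?_
  by_cases hs : s ∈ B <;> simp [hB, hs]

/-- The increments of the continuous part are those of `x` away from the jump times. -/
theorem contPart_sub_eq_measure_diff (hx : IsCadlagLFV x) {a b : ℝ≥0} (hab : a ≤ b) :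
    contPart x b - contPart x a = (upMeasure x (Ioc a b \ jumpTimes x)).toReal -
      (downMeasure x (Ioc a b \ jumpTimes x)).toReal := by
  have hJ := countable_jumpTimes hx
  have hK : (Ioc a b ∩ jumpTimes x).Countable := hJ.mono inter_subset_right
  have h1 := hasSum_measure_singleton hK (ne_top_of_le_ne_top (upMeasure_Ioc_ne_top hx a b)
    (measure_mono inter_subset_left))
  have h2 := hasSum_measure_singleton hK (ne_top_of_le_ne_top (downMeasure_Ioc_ne_top hx a b)
    (measure_mono inter_subset_left))
  have h3 : ∑' s : Ioc a b, jump x s = (upMeasure x (Ioc a b ∩ jumpTimes x)).toReal -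
      (downMeasure x (Ioc a b ∩ jumpTimes x)).toReal := by
    rw [← (h1.sub h2).tsum_eq]
    simp only [← jump_eq_measure_sub hx]
    rw [tsum_subtype (Ioc a b) (jump x), tsum_subtype (Ioc a b ∩ jumpTimes x) (jump x)]
    refine tsum_congr fun s => ?_
    by_cases h : s ∈ Ioc a b <;> by_cases h' : s ∈ jumpTimes x
    · rw [indicator_of_mem h, indicator_of_mem (mem_inter h h')]
    · rw [indicator_of_mem h, indicator_of_notMem fun h'' => h' h''.2]
      exact not_not.1 h'
    all_goals rw [indicator_of_notMem h, indicator_of_notMem fun h'' => h h''.1]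
  have h4 := measureReal_inter_add_sdiff (μ := upMeasure x) (s := Ioc a b) hJ.measurableSet
    (upMeasure_Ioc_ne_top hx a b)
  have h5 := measureReal_inter_add_sdiff (μ := downMeasure x) (s := Ioc a b) hJ.measurableSet
    (downMeasure_Ioc_ne_top hx a b)
  simp only [measureReal_def] at h4 h5
  rw [contPart_sub hx hab, h3, ← toReal_upMeasure_sub hx hab, ← h4, ← h5]
  ring

theorem upMeasure_contPart_Ioc_le (hx : IsCadlagLFV x) (a b : ℝ≥0) :
    upMeasure (contPart x) (Ioc a b) ≤ upMeasure x (Ioc a b \ jumpTimes x) := by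
  rcases le_or_gt b a with hab | hab
  · simp [Ioc_eq_empty (not_lt.2 hab)]
  have hJ := countable_jumpTimes hx
  rw [(isMeasureOf_upMeasure (isCadlagLFV_contPart hx)).2 a b hab, sdiff_eq,
    ← Measure.restrict_apply' hJ.measurableSet.compl]
  refine upVariation_le_measure (fun a b hab => ?_) a b
  rw [Measure.restrict_apply' hJ.measurableSet.compl, ← sdiff_eq, contPart_sub_eq_measure_diff hx hab]
  refine (ENNReal.ofReal_le_ofReal (sub_le_self _ ENNReal.toReal_nonneg)).trans
    ENNReal.ofReal_toReal_le

theorem upMeasure_le_contPart_add (hx : IsCadlagLFV x) (a b : ℝ≥0) :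
    upMeasure x (Ioc a b) ≤ upMeasure (contPart x) (Ioc a b) + upJumpMeasure x (Ioc a b) := by
  rcases le_or_gt b a with hab | hab
  · simp [Ioc_eq_empty (not_lt.2 hab)]
  rw [(isMeasureOf_upMeasure hx).2 a b hab, ← Measure.add_apply]
  refine upVariation_le_measure (fun a b hab => ?_) a b
  have hc := isCadlagLFV_contPart hx
  have h1 : x b - x a = (contPart x b - contPart x a) + ∑' s : Ioc a b, jump x s := by
    rw [contPart_sub hx hab]
    ring
  rw [h1, Measure.add_apply, upJumpMeasure_apply x measurableSet_Ioc]
  refine ENNReal.ofReal_add_le.trans (add_le_add ?_ ?_)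
  · rw [← toReal_upMeasure_sub hc hab]
    exact (ENNReal.ofReal_le_ofReal (sub_le_self _ ENNReal.toReal_nonneg)).trans
      ENNReal.ofReal_toReal_le
  · have hs := summable_jump hx a b
    have h2 : Summable fun s : Ioc a b => max (jump x s) 0 :=
      hs.of_nonneg_of_le (fun s => le_max_right _ _)
        fun s => max_le (le_abs_self _) (abs_nonneg _)
    have h3 : ∑' s : Ioc a b, jump x s ≤ ∑' s : Ioc a b, max (jump x s) 0 :=
      hs.of_abs.tsum_le_tsum (fun s => le_max_left _ _) h2
    refine (ENNReal.ofReal_le_ofReal h3).trans ?_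
    rw [ENNReal.ofReal_tsum_of_nonneg (fun s => le_max_right _ _) h2]
    simp

theorem upJumpMeasure_le (hx : IsCadlagLFV x) {B : Set ℝ≥0} (hB : MeasurableSet B) :
    upJumpMeasure x B ≤ upMeasure x (B ∩ jumpTimes x) := by
  have hJ := countable_jumpTimes hx
  have hK : (B ∩ jumpTimes x).Countable := hJ.mono inter_subset_right
  have h : ∑' s : ↥(B ∩ jumpTimes x), upMeasure x {(s : ℝ≥0)} = upMeasure x (B ∩ jumpTimes x) := by
    simpa using tsum_measure_preimage_singleton (μ := upMeasure x) hK (f := id) fun s _ =>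
      measurableSet_singleton s
  rw [upJumpMeasure_apply x hB, ← h, tsum_subtype B fun s => ENNReal.ofReal (jump x s),
    tsum_subtype (B ∩ jumpTimes x) fun s => upMeasure x {s}]
  refine ENNReal.tsum_le_tsum fun s => ?_
  by_cases h : s ∈ B
  · by_cases h' : s ∈ jumpTimes x
    · rw [indicator_of_mem h, indicator_of_mem (mem_inter h h'), jump_eq_measure_sub hx]
      exact (ENNReal.ofReal_le_ofReal (sub_le_self _ ENNReal.toReal_nonneg)).trans
        ENNReal.ofReal_toReal_le
    · have : jump x s = 0 := not_not.1 h'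
      simp [this, h]
  · simp [h]

/-- On every interval, `dx^cont₊` plus the positive jumps is at most `dx₊` off the jump times plus the
atoms of `dx₊`, that is `dx₊`, which is at most `dx^cont₊` plus the positive jumps. So there is
equality throughout. -/
theorem upMeasure_Ioc_decomposition (hx : IsCadlagLFV x) (a b : ℝ≥0) :
    upMeasure (contPart x) (Ioc a b) = upMeasure x (Ioc a b \ jumpTimes x) ∧
      upMeasure x (Ioc a b) = upMeasure (contPart x) (Ioc a b) + upJumpMeasure x (Ioc a b) := by
  have h1 := upMeasure_contPart_Ioc_le hx a b
  have h2 := upJumpMeasure_le hx (measurableSet_Ioc (a := a) (b := b))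
  have h3 := upMeasure_le_contPart_add hx a b
  have h4 := measure_inter_add_sdiff (μ := upMeasure x) (Ioc a b) (countable_jumpTimes hx).measurableSet
  have htop := upMeasure_Ioc_ne_top hx a b
  have h5 : upMeasure x (Ioc a b \ jumpTimes x) ≠ ∞ := ne_top_of_le_ne_top htop (measure_mono sdiff_subset)
  have h6 : upMeasure x (Ioc a b ∩ jumpTimes x) ≠ ∞ := ne_top_of_le_ne_top htop (measure_mono inter_subset_left)
  have h7 := ne_top_of_le_ne_top h5 h1
  have h8 := ne_top_of_le_ne_top h6 h2
  refine ⟨h1.antisymm ?_, h3.antisymm ?_⟩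
  · rw [← h4, add_comm] at h3
    have h9 := h3.trans (add_le_add le_rfl h2)
    exact (ENNReal.add_le_add_iff_right h6).1 h9
  · rw [← h4, add_comm (upMeasure x _)]
    exact add_le_add h1 h2

/-- `dx^cont₊` is `dx₊` away from the jump times. -/
theorem upMeasure_contPart (hx : IsCadlagLFV x) :
    upMeasure (contPart x) = (upMeasure x).restrict (jumpTimes x)ᶜ := by
  have hJ := (countable_jumpTimes hx).measurableSet.compl
  have hc := isCadlagLFV_contPart hx
  refine ext_of_Ioc_of_singleton_zero ?_ (fun a b _ => ?_) ?_ (upMeasure_Ioc_ne_top hc)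
  · rw [(isMeasureOf_upMeasure hc).1, eq_comm]
    exact Measure.restrict_le_self.absolutelyContinuous (isMeasureOf_upMeasure hx).1
  · rw [(upMeasure_Ioc_decomposition hx a b).1, Measure.restrict_apply' hJ, Set.sdiff_eq]
  · simp [(isMeasureOf_upMeasure hc).1]

/-- `dx₊ = dx^cont₊ + ∑ (Δx_s)₊ δ_s`. -/
theorem upMeasure_eq_contPart_add (hx : IsCadlagLFV x) :
    upMeasure x = upMeasure (contPart x) + upJumpMeasure x := by
  have hc := isCadlagLFV_contPart hx
  refine ext_of_Ioc_of_singleton_zero ?_ (fun a b _ => ?_) ?_ (upMeasure_Ioc_ne_top hx)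
  · rw [Measure.add_apply, (isMeasureOf_upMeasure hc).1, (isMeasureOf_upMeasure hx).1,
      upJumpMeasure_apply x (measurableSet_singleton 0), zero_add, eq_comm, ENNReal.tsum_eq_zero]
    rintro ⟨s, rfl⟩
    simp [jump_zero]
  · rw [Measure.add_apply, ← (upMeasure_Ioc_decomposition hx a b).2]
  · simp [(isMeasureOf_upMeasure hx).1]

/-! ### Measurability of the path -/

theorem IsCadlagLFV.measurable (hx : IsCadlagLFV x) : Measurable x := by
  have h : x = fun b => x 0 + ((upMeasure x (Ioc 0 b)).toReal - (downMeasure x (Ioc 0 b)).toReal) := by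
    funext b
    rw [toReal_upMeasure_sub hx zero_le]
    ring
  have hm : ∀ {μ : Measure ℝ≥0}, (∀ a b, μ (Ioc a b) ≠ ∞) →
      Measurable fun b => (μ (Ioc 0 b)).toReal := fun {μ} hμ =>
    Monotone.measurable fun p q hpq =>
      ENNReal.toReal_mono (hμ 0 q) (measure_mono (Ioc_subset_Ioc_right hpq))
  rw [h]
  exact ((hm (upMeasure_Ioc_ne_top hx)).sub (hm (downMeasure_Ioc_ne_top hx))).const_add _

theorem IsCadlagLFV.measurable_leftLim (hx : IsCadlagLFV x) : Measurable (Function.leftLim x) := by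
  have hj : Function.leftLim x = fun s => x s - jump x s := by
    funext s
    simp [jump]
  rw [hj]
  refine hx.measurable.sub (measurable_zero.measurable_of_countable_ne ?_)
  exact (countable_jumpTimes hx).mono fun s hs => Ne.symm hs

/-! ### The jump decomposition, for downward variation and on bounded intervals -/

theorem downMeasure_contPart (hx : IsCadlagLFV x) :
    downMeasure (contPart x) = (downMeasure x).restrict (jumpTimes x)ᶜ := by
  have h : jumpTimes (fun s => -x s) = jumpTimes x := by
    ext s
    simp [jumpTimes, jump_neg hx.cadlag]
  rw [downMeasure_eq, downMeasure_eq, ← contPart_neg hx.cadlag, upMeasure_contPart hx.neg, h]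

/-- The sum over `upJumps x t` may be extended by zero terms to all of `(0, t]`. -/
theorem tsum_upJumps (x : ℝ≥0 → ℝ) (t : ℝ≥0) {f : ℝ≥0 → ℝ≥0∞} (hf : ∀ s, jump x s ≤ 0 → f s = 0) :
    ∑' s : upJumps x t, f s = ∑' s : Ioc 0 t, f s := by
  rw [tsum_subtype (upJumps x t) f, tsum_subtype (Ioc 0 t) f]
  refine tsum_congr fun s => ?_
  rcases le_or_gt (jump x s) 0 with h | h
  · simp [indicator_apply, hf s h]
  · simp [indicator_apply, upJumps, h]

theorem restrict_upJumpMeasure (x : ℝ≥0 → ℝ) (t : ℝ≥0) :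
    (upJumpMeasure x).restrict (Ioc 0 t) =
      Measure.sum fun s : upJumps x t => ENNReal.ofReal (jump x s) • Measure.dirac (s : ℝ≥0) := by
  ext B hB
  rw [Measure.restrict_apply hB, upJumpMeasure_apply x (hB.inter measurableSet_Ioc),
    Measure.sum_apply _ hB]
  simp only [Measure.smul_apply, Measure.dirac_apply' _ hB, smul_eq_mul]
  rw [tsum_upJumps x t (f := fun s => ENNReal.ofReal (jump x s) * B.indicator 1 s)
    fun s hs => by simp [ENNReal.ofReal_of_nonpos hs],
    tsum_subtype (B ∩ Ioc 0 t) fun s => ENNReal.ofReal (jump x s),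
    tsum_subtype (Ioc 0 t) fun s => ENNReal.ofReal (jump x s) * B.indicator 1 s]
  refine tsum_congr fun s => ?_
  by_cases h : s ∈ B <;> by_cases h' : s ∈ Ioc 0 t <;> simp [h, h', -mem_Ioc]

theorem restrict_upMeasure (hx : IsCadlagLFV x) (t : ℝ≥0) :
    (upMeasure x).restrict (Ioc 0 t) = (upMeasure (contPart x)).restrict (Ioc 0 t) +
      Measure.sum fun s : upJumps x t => ENNReal.ofReal (jump x s) • Measure.dirac (s : ℝ≥0) := by
  rw [← restrict_upJumpMeasure, ← Measure.restrict_add, ← upMeasure_eq_contPart_add hx]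

theorem upJumps_neg (hx : IsCadlagLFV x) (t : ℝ≥0) :
    upJumps (fun s => -x s) t = downJumps x t := by
  ext s
  simp [upJumps, downJumps, jump_neg hx.cadlag]

theorem downJumps_neg (hx : IsCadlagLFV x) (t : ℝ≥0) :
    downJumps (fun s => -x s) t = upJumps x t := by
  ext s
  simp [upJumps, downJumps, jump_neg hx.cadlag]

theorem restrict_downMeasure (hx : IsCadlagLFV x) (t : ℝ≥0) :
    (downMeasure x).restrict (Ioc 0 t) = (downMeasure (contPart x)).restrict (Ioc 0 t) +
      Measure.sum fun s : downJumps x t =>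
        ENNReal.ofReal (-jump x s) • Measure.dirac (s : ℝ≥0) := by
  rw [downMeasure_eq, downMeasure_eq, restrict_upMeasure hx.neg t, contPart_neg hx.cadlag,
    upJumps_neg hx]
  simp only [jump_neg hx.cadlag]

/-! ### The times of the downcrossings of levels in a given set -/

theorem downVariation_le_totalVariation (hx : IsCadlagLFV x) {a b : ℝ≥0} (hab : a ≤ b) :
    downVariation x a b ≤ totalVariation x a b := by
  have h := abs_le.1 (abs_sub_le_totalVariation hx hab)
  rw [downVariation_eq, upVariation_eq hx.neg hab, totalVariation_neg,
    ENNReal.ofReal_le_iff_le_toReal (totalVariation_ne_top hx a b)]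
  linarith

theorem setLIntegral_numDescents_le (hx : IsCadlagLFV x) (A : Set ℝ) {a b : ℝ≥0} (hab : a ≤ b) :
    ∫⁻ z in A, numDescents x z a b ≤ totalVariation x a b :=
  (setLIntegral_le_lintegral _ _).trans
    ((lintegral_numDescents hx.cadlag.1 hab).le.trans (downVariation_le_totalVariation hx hab))

theorem setLIntegral_numDescents_ne_top (hx : IsCadlagLFV x) (A : Set ℝ) {a b : ℝ≥0} (hab : a ≤ b) :
    ∫⁻ z in A, numDescents x z a b ≠ ∞ :=
  ne_top_of_le_ne_top (totalVariation_ne_top hx a b) (setLIntegral_numDescents_le hx A hab)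

/-- Additivity in time: the level `x b`, at which it can fail, is a null set. -/
theorem setLIntegral_numDescents_add (x : ℝ≥0 → ℝ) (A : Set ℝ) {a b c : ℝ≥0} (hab : a ≤ b)
    (hbc : b ≤ c) : (∫⁻ z in A, numDescents x z a b) + ∫⁻ z in A, numDescents x z b c =
      ∫⁻ z in A, numDescents x z a c := by
  rw [← lintegral_add_left (measurable_numDescents _ _ _)]
  refine lintegral_congr_ae ?_
  filter_upwards [(countable_singleton (x b)).ae_notMem (volume.restrict A)] with z hz
  exact numDescents_add hab hbc fun h => hz h.symm

/-- The measure on times that gives `(a, b]` the integral over `A` of the number of downcrossings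
of the level `z` on `[a, b]`. It is the part of `(dx)₋` that is spent at levels in `A`. -/
noncomputable def descentMeasure (x : ℝ≥0 → ℝ) (A : Set ℝ) : Measure ℝ≥0 :=
  intervalMeasure fun a b => ∫⁻ z in A, numDescents x z a b

theorem isMeasureOf_descentMeasure (hx : IsCadlagLFV x) (A : Set ℝ) :
    IsMeasureOf (fun a b => ∫⁻ z in A, numDescents x z a b) (descentMeasure x A) := by
  have hsub : ∀ a b, a ≤ b → (∫⁻ z in A, numDescents x z 0 b).toReal -
      (∫⁻ z in A, numDescents x z 0 a).toReal = (∫⁻ z in A, numDescents x z a b).toReal := by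
    intro a b hab
    rw [← setLIntegral_numDescents_add x A (zero_le (a := a)) hab, ENNReal.toReal_add
      (setLIntegral_numDescents_ne_top hx A zero_le) (setLIntegral_numDescents_ne_top hx A hab)]
    ring
  refine intervalMeasure_spec (exists_isMeasureOf
    (fun b => (∫⁻ z in A, numDescents x z 0 b).toReal) (fun a b hab => ?_) (fun t => ?_)
    fun a b hab => ?_)
  · exact sub_nonneg.1 ((hsub a b hab).symm ▸ ENNReal.toReal_nonneg)
  · rw [ContinuousWithinAt, tendsto_iff_dist_tendsto_zero]
    refine squeeze_zero' (Eventually.of_forall fun _ => dist_nonneg) ?_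
      (tendsto_totalVariation hx t)
    filter_upwards [self_mem_nhdsWithin] with b hb
    rw [Real.dist_eq, hsub t b hb, abs_of_nonneg ENNReal.toReal_nonneg]
    exact ENNReal.toReal_mono (totalVariation_ne_top hx t b) (setLIntegral_numDescents_le hx A hb)
  · rw [hsub a b hab.le, ENNReal.ofReal_toReal (setLIntegral_numDescents_ne_top hx A hab.le)]

theorem descentMeasure_Ioc_ne_top (hx : IsCadlagLFV x) (A : Set ℝ) (a b : ℝ≥0) :
    descentMeasure x A (Ioc a b) ≠ ∞ := by
  rcases lt_or_ge a b with h | h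
  · rw [(isMeasureOf_descentMeasure hx A).2 a b h]
    exact setLIntegral_numDescents_ne_top hx A h.le
  · simp [Ioc_eq_empty (not_lt.2 h)]

theorem descentMeasure_add_compl (hx : IsCadlagLFV x) {A : Set ℝ} (hA : MeasurableSet A) :
    descentMeasure x A + descentMeasure x Aᶜ = downMeasure x := by
  have h1 := isMeasureOf_descentMeasure hx A
  have h2 := isMeasureOf_descentMeasure hx Aᶜ
  refine (ext_of_Ioc_of_singleton_zero ?_ (fun a b hab => ?_) ?_ (downMeasure_Ioc_ne_top hx)).symm
  · simp [h1.1, h2.1, (isMeasureOf_downMeasure hx).1]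
  · rw [Measure.add_apply, h1.2 a b hab, h2.2 a b hab, (isMeasureOf_downMeasure hx).2 a b hab,
      lintegral_add_compl _ hA, lintegral_numDescents hx.cadlag.1 hab.le]
  · simp [(isMeasureOf_downMeasure hx).1]

/-- Near a time at which `x` is continuous, with value in an open set `A`, only levels in `A` are
crossed. -/
theorem descentMeasure_compl_eq_zero (hx : IsCadlagLFV x) {A : Set ℝ} (hA : IsOpen A) :
    descentMeasure x Aᶜ {s | 0 < s ∧ ContinuousAt x s ∧ x s ∈ A} = 0 := by
  refine measure_null_of_locally_null _ ?_
  rintro s ⟨hs, hc, hsA⟩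
  obtain ⟨ε, hε, hεA⟩ := Metric.isOpen_iff.1 hA (x s) hsA
  have h1 : x ⁻¹' Metric.ball (x s) ε ∈ 𝓝 s := hc (Metric.ball_mem_nhds _ hε)
  obtain ⟨b, hsb⟩ : ∃ b, s < b := exists_gt s
  obtain ⟨l, u, ⟨hl, hu⟩, hlu⟩ := (mem_nhds_iff_exists_Ioo_subset' ⟨0, hs⟩ ⟨b, hsb⟩).1 h1
  obtain ⟨a, hla, has⟩ := exists_between hl
  obtain ⟨b, hsb, hbu⟩ := exists_between hu
  refine ⟨Ioc a b, mem_nhdsWithin_of_mem_nhds (mem_of_superset (Ioo_mem_nhds has hsb)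
    Ioo_subset_Ioc_self), ?_⟩
  rw [(isMeasureOf_descentMeasure hx Aᶜ).2 a b (has.trans hsb)]
  refine (setLIntegral_congr_fun hA.measurableSet.compl fun z hz => ?_).trans lintegral_zero
  apply numDescents_eq_zero
  have hz : z ∉ Metric.ball (x s) ε := fun h => hz (hεA h)
  have hball : ∀ r ∈ Icc a b, x r ∈ Metric.ball (x s) ε := fun r hr =>
    hlu ⟨hla.trans_le hr.1, hr.2.trans_lt hbu⟩
  rw [Real.ball_eq_Ioo] at hz hball
  rcases le_or_gt z (x s - ε) with h | h
  · exact Or.inr fun r hr => h.trans (hball r hr).1.le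
  · refine Or.inl fun r hr => (hball r hr).2.le.trans ?_
    by_contra hcon
    exact hz ⟨h, not_le.1 hcon⟩

/-- A downward jump spends its variation on all levels that it jumps over. -/
theorem volume_le_descentMeasure_singleton (hx : IsCadlagLFV x) (A : Set ℝ) {s : ℝ≥0} (hs : 0 < s) :
    volume (A ∩ Ioo (x s) (Function.leftLim x s)) ≤ descentMeasure x A {s} := by
  obtain ⟨u, hu, hus, hlim⟩ := exists_seq_strictMono_tendsto' hs
  have h1 := tendsto_measure_Ioc_singleton (fun a => descentMeasure_Ioc_ne_top hx A a s) hu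
    (fun n => (hus n).2) hlim
  have h2 : Tendsto (fun n => ENNReal.ofReal (Function.leftLim x s - x (u n))) atTop (𝓝 0) := by
    have h3 := ((hx.cadlag.tendsto_leftLim hs).comp (tendsto_nhdsWithin_iff.2
      ⟨hlim, Eventually.of_forall fun n => (hus n).2⟩)).const_sub (Function.leftLim x s)
    simpa using ENNReal.tendsto_ofReal h3
  refine ge_of_tendsto (by simpa using h1.add h2) (Eventually.of_forall fun n => ?_)
  rw [(isMeasureOf_descentMeasure hx A).2 (u n) s (hus n).2]
  have hsub : A ∩ Ioo (x s) (Function.leftLim x s) ⊆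
      (A ∩ Ioo (x s) (x (u n))) ∪ Ico (x (u n)) (Function.leftLim x s) := by
    rintro z ⟨hzA, hz⟩
    rcases lt_or_ge z (x (u n)) with h | h
    · exact Or.inl ⟨hzA, hz.1, h⟩
    · exact Or.inr ⟨h, hz.2⟩
  refine (measure_mono hsub).trans ((measure_union_le _ _).trans (add_le_add ?_ ?_))
  · rw [inter_comm, ← Measure.restrict_apply measurableSet_Ioo,
      ← lintegral_indicator_one measurableSet_Ioo]
    exact lintegral_mono (indicator_le fun z hz => one_le_numDescents (hus n).2.le hz.2 hz.1)
  · rw [Real.volume_Ico]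

/-! ### The occupation measure of the downward variation -/

/-- The image under `x` of the continuous downward variation on `(0, t]`, plus Lebesgue measure on
each interval that is jumped over downwards. -/
noncomputable def downOccupation (x : ℝ≥0 → ℝ) (t : ℝ≥0) : Measure ℝ :=
  ((downMeasure (contPart x)).restrict (Ioc 0 t)).map x +
    Measure.sum fun s : downJumps x t => volume.restrict (Ioo (x s) (Function.leftLim x s))

theorem downOccupation_apply (hx : IsCadlagLFV x) (t : ℝ≥0) {A : Set ℝ} (hA : MeasurableSet A) :
    downOccupation x t A = downMeasure (contPart x) (Ioc 0 t ∩ x ⁻¹' A) +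
      ∑' s : downJumps x t, volume (A ∩ Ioo (x s) (Function.leftLim x s)) := by
  rw [downOccupation, Measure.add_apply, Measure.map_apply hx.measurable hA,
    Measure.restrict_apply (hx.measurable hA), Measure.sum_apply _ hA, inter_comm]
  simp only [Measure.restrict_apply hA]

theorem downOccupation_univ (hx : IsCadlagLFV x) (t : ℝ≥0) :
    downOccupation x t univ = downMeasure x (Ioc 0 t) := by
  rw [downOccupation_apply hx t MeasurableSet.univ, ← Measure.restrict_apply_self (downMeasure x),
    restrict_downMeasure hx, Measure.add_apply, Measure.restrict_apply_self,
    Measure.sum_apply _ measurableSet_Ioc, preimage_univ, inter_univ]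
  congr 1
  refine tsum_congr fun s => ?_
  have hs : (s : ℝ≥0) ∈ Ioc 0 t := ⟨s.2.1, s.2.2.1⟩
  rw [Measure.smul_apply, Measure.dirac_apply_of_mem hs, univ_inter, Real.volume_Ioo, jump]
  simp

/-- The jump times contribute at least the Lebesgue measures of the parts of `A` jumped over, and at
the other times with values in `A` all of `(dx)₋` is spent at levels in `A`. -/
theorem downOccupation_le_of_isOpen (hx : IsCadlagLFV x) {t : ℝ≥0} (ht : 0 < t) {A : Set ℝ}
    (hA : IsOpen A) : downOccupation x t A ≤ ∫⁻ z in A, numDescents x z 0 t := by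
  have hJ := countable_jumpTimes hx
  have hAm := hA.measurableSet
  refine le_of_le_of_eq ?_ ((isMeasureOf_descentMeasure hx A).2 0 t ht)
  rw [downOccupation_apply hx t hAm, ← measure_inter_add_sdiff (Ioc 0 t) hJ.measurableSet, add_comm]
  refine add_le_add ?_ ?_
  · have hsub : downJumps x t ⊆ Ioc 0 t ∩ jumpTimes x := fun s hs => ⟨⟨hs.1, hs.2.1⟩, hs.2.2.ne⟩
    have hd : (downJumps x t).Countable := hJ.mono (hsub.trans inter_subset_right)
    refine le_trans ?_ (measure_mono hsub)
    have h : ∑' s : downJumps x t, descentMeasure x A {(s : ℝ≥0)} =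
        descentMeasure x A (downJumps x t) := by
      simpa using tsum_measure_preimage_singleton (μ := descentMeasure x A) hd (f := id)
        fun s _ => measurableSet_singleton s
    rw [← h]
    exact ENNReal.tsum_le_tsum fun s => volume_le_descentMeasure_singleton hx A s.2.1
  · rw [downMeasure_contPart hx, Measure.restrict_apply' hJ.measurableSet.compl,
      ← descentMeasure_add_compl hx hAm, Measure.add_apply]
    have hsub : Ioc 0 t ∩ x ⁻¹' A ∩ (jumpTimes x)ᶜ ⊆ {s | 0 < s ∧ ContinuousAt x s ∧ x s ∈ A} :=
      fun s hs => ⟨hs.1.1.1, hx.cadlag.continuousAt (not_not.1 hs.2), hs.1.2⟩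
    rw [measure_mono_null hsub (descentMeasure_compl_eq_zero hx hA), add_zero]
    exact measure_mono fun s hs => ⟨hs.1.1, hs.2⟩

/-- The number of downcrossings is a density of the occupation measure of the downward variation:
the inequality for open sets extends to Borel sets by outer regularity, and the total masses are
both `(dx)₋ (0, t]`. -/
theorem downOccupation_eq (hx : IsCadlagLFV x) {t : ℝ≥0} (ht : 0 < t) :
    downOccupation x t = volume.withDensity fun z => numDescents x z 0 t := by
  have htop : ∫⁻ z, numDescents x z 0 t ≠ ∞ := by
    simpa using setLIntegral_numDescents_ne_top hx univ (zero_le (a := t))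
  have hfin := isFiniteMeasure_withDensity htop
  have hle : downOccupation x t ≤ volume.withDensity fun z => numDescents x z 0 t := by
    refine Measure.le_iff'.2 fun A => ?_
    rw [A.measure_eq_iInf_isOpen (volume.withDensity fun z => numDescents x z 0 t)]
    refine le_iInf fun U => le_iInf fun hAU => le_iInf fun hU => (measure_mono hAU).trans ?_
    rw [withDensity_apply _ hU.measurableSet]
    exact downOccupation_le_of_isOpen hx ht hU
  have : IsFiniteMeasure (downOccupation x t) := ⟨(hle univ).trans_lt (measure_lt_top _ _)⟩
  refine Measure.eq_of_le_of_measure_univ_eq hle ?_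
  rw [downOccupation_univ hx, withDensity_apply _ MeasurableSet.univ, setLIntegral_univ,
    lintegral_numDescents hx.cadlag.1 zero_le, (isMeasureOf_downMeasure hx).2 0 t ht]

/-! ### The occupation identities for sets of levels -/

theorem measurable_of_toENNReal {N : ℝ → ℕ∞} (h : Measurable fun z => (N z : ℝ≥0∞)) :
    Measurable N := by
  refine measurable_to_countable' fun n => ?_
  have : N ⁻¹' {n} = (fun z => (N z : ℝ≥0∞)) ⁻¹' {(n : ℝ≥0∞)} := by
    ext z
    simp
  rw [this]
  exact h (measurableSet_singleton _)

theorem measurable_downCrossings (hx : IsCadlagLFV x) (t : ℝ≥0) :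
    Measurable fun z => downCrossings x 0 t z := by
  refine measurable_of_toENNReal ?_
  simp only [toENNReal_downCrossings hx.cadlag.1]
  exact measurable_numDescents x 0 t

/-- Upcrossings of `z` by `x` are downcrossings of `-z` by `-x`, so that the upward statements follow
from the downward ones. -/
theorem upCrossings_eq (x : ℝ≥0 → ℝ) (t : ℝ≥0) (z : ℝ) :
    upCrossings x 0 t z = downCrossings (fun s => -x s) 0 t (-z) := rfl

theorem measurable_upCrossings (hx : IsCadlagLFV x) (t : ℝ≥0) :
    Measurable fun z => upCrossings x 0 t z :=
  (measurable_downCrossings hx.neg t).comp measurable_neg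

theorem crossings_eq (x : ℝ≥0 → ℝ) (t : ℝ≥0) (z : ℝ) :
    crossings x 0 t z = upCrossings x 0 t z + downCrossings x 0 t z :=
  tendsto_nhds_unique (tendsto_crossings x 0 t z)
    ((tendsto_upCrossings x 0 t z).add (tendsto_downCrossings x 0 t z))

theorem measurable_crossings (hx : IsCadlagLFV x) (t : ℝ≥0) :
    Measurable fun z => crossings x 0 t z := by
  simp only [crossings_eq]
  exact (Measurable.of_discrete (f := fun p : ℕ∞ × ℕ∞ => p.1 + p.2)).comp
    ((measurable_upCrossings hx t).prodMk (measurable_downCrossings hx t))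

theorem setLIntegral_downCrossings (hx : IsCadlagLFV x) {t : ℝ≥0} (ht : 0 < t) {A : Set ℝ}
    (hA : MeasurableSet A) : ∫⁻ z in A, ((downCrossings x 0 t z : ℕ∞) : ℝ≥0∞) =
      downMeasure (contPart x) (Ioc 0 t ∩ x ⁻¹' A) +
        ∑' s : downJumps x t, volume (A ∩ Ioo (x s) (Function.leftLim x s)) := by
  simp only [toENNReal_downCrossings hx.cadlag.1]
  rw [← downOccupation_apply hx t hA, downOccupation_eq hx ht, withDensity_apply _ hA]

theorem setLIntegral_upCrossings (hx : IsCadlagLFV x) {t : ℝ≥0} (ht : 0 < t) {A : Set ℝ}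
    (hA : MeasurableSet A) : ∫⁻ z in A, ((upCrossings x 0 t z : ℕ∞) : ℝ≥0∞) =
      upMeasure (contPart x) (Ioc 0 t ∩ x ⁻¹' A) +
        ∑' s : upJumps x t, volume (A ∩ Ioo (Function.leftLim x s) (x s)) := by
  have hm : Measurable fun z => ((downCrossings (fun s => -x s) 0 t z : ℕ∞) : ℝ≥0∞) :=
    Measurable.of_discrete.comp (measurable_downCrossings hx.neg t)
  have h1 := (Measure.measurePreserving_neg (volume : Measure ℝ)).setLIntegral_comp_preimage
    hA.neg hm
  have h2 : Neg.neg ⁻¹' (-A) = A := by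
    ext z
    simp
  simp only [upCrossings_eq]
  rw [h2] at h1
  rw [h1, setLIntegral_downCrossings hx.neg ht hA.neg, downMeasure_eq, contPart_neg hx.cadlag,
    downJumps_neg hx]
  simp only [neg_neg]
  congr 1
  · congr 1
    ext s
    simp
  · refine tsum_congr fun s => ?_
    rw [leftLim_neg hx.cadlag, ← Measure.measure_neg]
    congr 1
    ext z
    simp [and_comm]

theorem jumps_eq (x : ℝ≥0 → ℝ) (t : ℝ≥0) : jumps x t = upJumps x t ∪ downJumps x t := by
  ext s
  simp only [jumps, upJumps, downJumps, mem_ofPred_eq, mem_union, ← and_or_left, ne_iff_lt_or_gt,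
    or_comm]

theorem disjoint_upJumps_downJumps (x : ℝ≥0 → ℝ) (t : ℝ≥0) :
    Disjoint (upJumps x t) (downJumps x t) :=
  disjoint_left.2 fun _ h h' => lt_asymm h.2.2 h'.2.2

theorem tsum_jumps (x : ℝ≥0 → ℝ) (t : ℝ≥0) (f : ℝ≥0 → ℝ≥0∞) :
    ∑' s : jumps x t, f s = ∑' s : upJumps x t, f s + ∑' s : downJumps x t, f s := by
  rw [jumps_eq]
  exact ENNReal.summable.tsum_union_disjoint (disjoint_upJumps_downJumps x t) ENNReal.summable

theorem leftLim_lt_of_mem_upJumps {t s : ℝ≥0} (hs : s ∈ upJumps x t) :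
    Function.leftLim x s < x s := sub_pos.1 hs.2.2

theorem lt_leftLim_of_mem_downJumps {t s : ℝ≥0} (hs : s ∈ downJumps x t) :
    x s < Function.leftLim x s := sub_neg.1 hs.2.2

theorem setLIntegral_crossings (hx : IsCadlagLFV x) {t : ℝ≥0} (ht : 0 < t) {A : Set ℝ}
    (hA : MeasurableSet A) : ∫⁻ z in A, ((crossings x 0 t z : ℕ∞) : ℝ≥0∞) =
      variationMeasure (contPart x) (Ioc 0 t ∩ x ⁻¹' A) +
        ∑' s : jumps x t, volume (A ∩ Ioo (min (Function.leftLim x s) (x s))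
          (max (Function.leftLim x s) (x s))) := by
  simp only [crossings_eq, ENat.toENNReal_add]
  have hm : Measurable fun z => ((upCrossings x 0 t z : ℕ∞) : ℝ≥0∞) :=
    Measurable.of_discrete.comp (measurable_upCrossings hx t)
  rw [lintegral_add_left hm,
    setLIntegral_upCrossings hx ht hA, setLIntegral_downCrossings hx ht hA,
    variationMeasure_eq (isCadlagLFV_contPart hx), Measure.add_apply,
    tsum_jumps x t fun s => volume (A ∩ Ioo (min (Function.leftLim x s) (x s))
          (max (Function.leftLim x s) (x s))), add_add_add_comm]
  congr 2
  · refine tsum_congr fun s => ?_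
    have h := (leftLim_lt_of_mem_upJumps s.2).le
    rw [min_eq_left h, max_eq_right h]
  · refine tsum_congr fun s => ?_
    have h := (lt_leftLim_of_mem_downJumps s.2).le
    rw [min_eq_right h, max_eq_left h]

theorem restrict_variationMeasure (hx : IsCadlagLFV x) (t : ℝ≥0) :
    (variationMeasure x).restrict (Ioc 0 t) = (variationMeasure (contPart x)).restrict (Ioc 0 t) +
      Measure.sum fun s : jumps x t => ENNReal.ofReal |jump x s| • Measure.dirac (s : ℝ≥0) := by
  rw [variationMeasure_eq hx, variationMeasure_eq (isCadlagLFV_contPart hx), Measure.restrict_add,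
    Measure.restrict_add, restrict_upMeasure hx, restrict_downMeasure hx, add_add_add_comm]
  congr 1
  ext B hB
  rw [Measure.add_apply, Measure.sum_apply _ hB, Measure.sum_apply _ hB, Measure.sum_apply _ hB,
    tsum_jumps x t fun s => (ENNReal.ofReal |jump x s| • Measure.dirac (s : ℝ≥0)) B]
  congr 1
  · refine tsum_congr fun s => ?_
    rw [abs_of_pos s.2.2.2]
  · refine tsum_congr fun s => ?_
    rw [abs_of_neg s.2.2.2]

/-! ### Locally bounded functions along the path -/

theorem IsLocallyBounded.exists_bound {g : ℝ → ℝ} (hg : IsLocallyBounded g) (K : ℝ) :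
    ∃ C, ∀ z ∈ Icc (-K) K, |g z| ≤ C := by
  refine isCompact_Icc.induction_on (p := fun s => ∃ C, ∀ z ∈ s, |g z| ≤ C) ⟨0, by simp⟩
    (fun s t hst ⟨C, hC⟩ => ⟨C, fun z hz => hC z (hst hz)⟩) ?_ fun a _ => ?_
  · rintro s t ⟨C, hC⟩ ⟨D, hD⟩
    exact ⟨max C D, fun z hz => hz.elim (fun h => (hC z h).trans (le_max_left _ _))
      fun h => (hD z h).trans (le_max_right _ _)⟩
  · obtain ⟨U, hU, C, hC⟩ := hg a
    exact ⟨U, mem_nhdsWithin_of_mem_nhds hU, C, hC⟩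

theorem exists_bound_path (hx : IsCadlagLFV x) (t : ℝ≥0) :
    ∃ K, ∀ s ≤ t, x s ∈ Icc (-K) K ∧ Function.leftLim x s ∈ Icc (-K) K := by
  refine ⟨|x 0| + (totalVariation x 0 t).toReal, ?_⟩
  have h : ∀ s ≤ t, x s ∈ Icc (-(|x 0| + (totalVariation x 0 t).toReal))
      (|x 0| + (totalVariation x 0 t).toReal) := by
    intro s hs
    have h1 := abs_sub_le_totalVariation hx (zero_le (a := s))
    have h2 : (totalVariation x 0 s).toReal ≤ (totalVariation x 0 t).toReal :=
      ENNReal.toReal_mono (totalVariation_ne_top hx 0 t)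
        (eVariationOn.mono x (Icc_subset_Icc_right hs))
    have h3 := abs_add_le (x s - x 0) (x 0)
    rw [sub_add_cancel] at h3
    exact abs_le.1 (by linarith)
  refine fun s hs => ⟨h s hs, ?_⟩
  rcases (zero_le (a := s)).eq_or_lt with rfl | h0
  · rw [leftLim_zero]
    exact h 0 hs
  · have hne : (𝓝[<] s).NeBot := nhdsLT_neBot_of_exists_lt ⟨0, h0⟩
    refine isClosed_Icc.mem_of_tendsto (hx.cadlag.tendsto_leftLim h0) ?_
    filter_upwards [self_mem_nhdsWithin] with r hr
    exact h r ((le_of_lt hr).trans hs)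

theorem integrableOn_comp {ρ : Measure ℝ≥0} {t : ℝ≥0} (hρ : ρ (Ioc 0 t) ≠ ∞) {w : ℝ≥0 → ℝ}
    (hw : Measurable w) {g : ℝ → ℝ} (hg : Measurable g) (hgb : IsLocallyBounded g) {K : ℝ}
    (hK : ∀ s ≤ t, w s ∈ Icc (-K) K) : IntegrableOn (fun s => g (w s)) (Ioc 0 t) ρ := by
  obtain ⟨C, hC⟩ := hgb.exists_bound K
  refine Measure.integrableOn_of_bounded (M := C) hρ (hg.comp hw).aestronglyMeasurable ?_
  filter_upwards [ae_restrict_mem measurableSet_Ioc] with s hs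
  exact hC _ (hK s hs.2)

theorem intervalIntegrable_of_isLocallyBounded {g : ℝ → ℝ} (hg : Measurable g)
    (hgb : IsLocallyBounded g) (a b : ℝ) : IntervalIntegrable g volume a b := by
  obtain ⟨C, hC⟩ := hgb.exists_bound (max |a| |b|)
  rw [intervalIntegrable_iff]
  refine Measure.integrableOn_of_bounded (M := C) (by simp [uIoc]) hg.aestronglyMeasurable ?_
  filter_upwards [ae_restrict_mem measurableSet_uIoc] with z hz
  refine hC z ?_
  rw [uIoc, mem_Ioc, min_lt_iff, le_max_iff] at hz
  have h1 := le_max_left |a| |b|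
  have h2 := le_max_right |a| |b|
  have h3 := neg_abs_le a
  have h4 := neg_abs_le b
  have h5 := le_abs_self a
  have h6 := le_abs_self b
  constructor
  · rcases hz.1 with h | h <;> linarith
  · rcases hz.2 with h | h <;> linarith

/-! ### The change of variables formula -/

theorem ae_downCrossings_ne_top (hx : IsCadlagLFV x) (t : ℝ≥0) :
    ∀ᵐ z : ℝ, downCrossings x 0 t z ≠ ⊤ := by
  have h : ∫⁻ z, numDescents x z 0 t ≠ ∞ := by
    simpa using setLIntegral_numDescents_ne_top hx univ (zero_le (a := t))
  filter_upwards [ae_lt_top (measurable_numDescents x 0 t) h] with z hz hz'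
  rw [← toENNReal_downCrossings hx.cadlag.1, hz'] at hz
  simp at hz

theorem ae_upCrossings_ne_top (hx : IsCadlagLFV x) (t : ℝ≥0) :
    ∀ᵐ z : ℝ, upCrossings x 0 t z ≠ ⊤ :=
  (Measure.measurePreserving_neg (volume : Measure ℝ)).quasiMeasurePreserving.ae
    (ae_downCrossings_ne_top hx.neg t)

theorem ae_crossings_ne_top (hx : IsCadlagLFV x) (t : ℝ≥0) :
    ∀ᵐ z : ℝ, crossings x 0 t z ≠ ⊤ := by
  filter_upwards [ae_upCrossings_ne_top hx t, ae_downCrossings_ne_top hx t] with z h1 h2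
  rw [crossings_eq]
  exact WithTop.add_ne_top.2 ⟨h1, h2⟩

/-- The integral form of an occupation identity. Here `N` is a number of crossings, `μ` and `η` are
the corresponding variation measures of `x` and of its continuous part, `S` is the set of the jump
times that count, and `(l s, r s)` is the interval jumped over at time `s`. -/
theorem occupation_formula (hx : IsCadlagLFV x) {N : ℝ → ℕ∞} (hN : Measurable N)
    (hNtop : ∀ᵐ z : ℝ, N z ≠ ⊤) {η μ : Measure ℝ≥0} {S : Set ℝ≥0} {l r : ℝ≥0 → ℝ} {t : ℝ≥0} {K : ℝ}
    (hxK : ∀ s ≤ t, x s ∈ Icc (-K) K ∧ Function.leftLim x s ∈ Icc (-K) K)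
    (hS : ∀ s ∈ S, l s ≤ r s ∧ l s ∈ Icc (-K) K ∧ r s ∈ Icc (-K) K)
    (hfin : μ (Ioc 0 t) ≠ ∞)
    (hμ : μ.restrict (Ioc 0 t) = η.restrict (Ioc 0 t) +
      Measure.sum fun s : S => ENNReal.ofReal (r s - l s) • Measure.dirac (s : ℝ≥0))
    (hJ : η (jumpTimes x) = 0)
    (hocc : ∀ A, MeasurableSet A → ∫⁻ z in A, (N z : ℝ≥0∞) =
      η (Ioc 0 t ∩ x ⁻¹' A) + ∑' s : S, volume (A ∩ Ioo (l s) (r s)))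
    {g : ℝ → ℝ} (hg : Measurable g) (hgb : IsLocallyBounded g) :
    Integrable (fun z => ((N z).toNat : ℝ) * g z) ∧
      IntegrableOn (fun s => g (Function.leftLim x s)) (Ioc 0 t) μ ∧
      IntegrableOn (fun s => g (Function.leftLim x s)) (Ioc 0 t) η ∧
      IntegrableOn (fun s => g (x s)) (Ioc 0 t) η ∧
      Summable (fun s : S => ∫ z in (l s)..(r s), (g z - g (Function.leftLim x s))) ∧
      Summable (fun s : S => ∫ z in (l s)..(r s), g z) ∧
      ∫ z, ((N z).toNat : ℝ) * g z = (∫ s in Ioc 0 t, g (Function.leftLim x s) ∂μ) +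
        ∑' s : S, ∫ z in (l s)..(r s), (g z - g (Function.leftLim x s)) ∧
      ∫ z, ((N z).toNat : ℝ) * g z = (∫ s in Ioc 0 t, g (Function.leftLim x s) ∂η) +
        ∑' s : S, ∫ z in (l s)..(r s), g z ∧
      ∫ z, ((N z).toNat : ℝ) * g z = (∫ s in Ioc 0 t, g (x s) ∂η) +
        ∑' s : S, ∫ z in (l s)..(r s), g z := by
  set σ : Measure ℝ := Measure.sum fun s : S => volume.restrict (Ioo (l s) (r s)) with hσ
  set ν : Measure ℝ := volume.withDensity fun z => (N z : ℝ≥0∞) with hν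
  have hNm : Measurable fun z => (N z : ℝ≥0∞) := Measurable.of_discrete.comp hN
  have hηfin : η (Ioc 0 t) ≠ ∞ := by
    refine ne_top_of_le_ne_top hfin ?_
    rw [← Measure.restrict_apply_self μ, hμ, Measure.add_apply, Measure.restrict_apply_self]
    exact le_self_add
  have hνeq : ν = (η.restrict (Ioc 0 t)).map x + σ := by
    ext A hA
    rw [hν, withDensity_apply _ hA, hocc A hA, Measure.add_apply, Measure.map_apply hx.measurable hA,
      Measure.restrict_apply (hx.measurable hA), Measure.sum_apply _ hA, inter_comm]
    simp only [Measure.restrict_apply hA]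
  have hνuniv : ν univ = μ (Ioc 0 t) := by
    rw [hν, withDensity_apply _ MeasurableSet.univ, hocc univ MeasurableSet.univ,
      ← Measure.restrict_apply_univ (μ := μ), hμ, Measure.add_apply,
      Measure.sum_apply _ MeasurableSet.univ]
    simp
  have hνfin : IsFiniteMeasure ν := ⟨by rw [hνuniv]; exact hfin.lt_top⟩
  have hνK : ∀ᵐ z ∂ν, z ∈ Icc (-K) K := by
    rw [ae_iff]
    change ν (Icc (-K) K)ᶜ = 0
    have hm : MeasurableSet (Icc (-K) K)ᶜ := measurableSet_Icc.compl
    rw [hν, withDensity_apply _ hm, hocc _ hm]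
    have h1 : Ioc 0 t ∩ x ⁻¹' (Icc (-K) K)ᶜ = ∅ :=
      eq_empty_of_forall_notMem fun s hs => hs.2 (hxK s hs.1.2).1
    have h2 : ∀ s : S, (Icc (-K) K)ᶜ ∩ Ioo (l s) (r s) = ∅ := fun s =>
      eq_empty_of_forall_notMem fun z hz => hz.1
        ⟨(hS s s.2).2.1.1.trans hz.2.1.le, hz.2.2.le.trans (hS s s.2).2.2.2⟩
    rw [h1]
    simp [h2]
  have hgν : Integrable g ν := by
    obtain ⟨C, hC⟩ := hgb.exists_bound K
    refine Integrable.of_bound hg.aestronglyMeasurable C ?_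
    filter_upwards [hνK] with z hz
    exact hC z hz
  have hNlt : ∀ᵐ z : ℝ, (N z : ℝ≥0∞) < ∞ := by
    filter_upwards [hNtop] with z hz
    rw [lt_top_iff_ne_top]
    simpa using hz
  have htoReal : ∀ z, ((N z : ℝ≥0∞)).toReal = ((N z).toNat : ℝ) := fun z => by
    cases N z <;> simp
  have hint : Integrable (fun z => ((N z).toNat : ℝ) * g z) := by
    have h := (integrable_withDensity_iff_integrable_smul' hNm hNlt).1 hgν
    simpa only [htoReal, smul_eq_mul] using h
  have hgm : Integrable g ((η.restrict (Ioc 0 t)).map x) :=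
    hgν.mono_measure (hνeq ▸ Measure.le_add_right le_rfl)
  have hgσ : Integrable g σ := hgν.mono_measure (hνeq ▸ Measure.le_add_left le_rfl)
  have hsum : HasSum (fun s : S => ∫ z in (l s)..(r s), g z) (∫ z, g z ∂σ) := by
    have h := hasSum_integral_measure hgσ
    refine h.congr_fun fun s => ?_
    rw [intervalIntegral.integral_of_le (hS s s.2).1, integral_Ioc_eq_integral_Ioo]
  have hlm := hx.measurable_leftLim
  have hil := fun {ρ : Measure ℝ≥0} (hρ : ρ (Ioc 0 t) ≠ ∞) =>
    integrableOn_comp hρ hlm hg hgb fun s hs => (hxK s hs).2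
  have e3 : ∫ z, ((N z).toNat : ℝ) * g z = (∫ s in Ioc 0 t, g (x s) ∂η) +
      ∑' s : S, ∫ z in (l s)..(r s), g z := by
    have h := integral_withDensity_eq_integral_toReal_smul hNm hNlt g
    simp only [htoReal, smul_eq_mul] at h
    rw [← h, ← hν, hνeq, integral_add_measure hgm hgσ, hsum.tsum_eq,
      integral_map hx.measurable.aemeasurable hg.aestronglyMeasurable]
  have hae : ∫ s in Ioc 0 t, g (Function.leftLim x s) ∂η = ∫ s in Ioc 0 t, g (x s) ∂η := by
    refine integral_congr_ae (ae_restrict_of_ae ?_)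
    filter_upwards [measure_eq_zero_iff_ae_notMem.1 hJ] with s hs
    rw [sub_eq_zero.1 (not_not.1 hs)]
  have e2 := e3
  rw [← hae] at e2
  -- the atoms of `μ` compensate the terms `g (x_{s-})` of the first sum
  have hli := hil hfin
  rw [IntegrableOn, hμ] at hli
  have hsum2 := hasSum_integral_measure (hli.mono_measure (Measure.le_add_left le_rfl))
  have hsum3 : HasSum (fun s : S => ∫ z in (l s)..(r s), (g z - g (Function.leftLim x s)))
      (∫ z, g z ∂σ - ∫ s, g (Function.leftLim x s) ∂(Measure.sum fun s : S =>
        ENNReal.ofReal (r s - l s) • Measure.dirac (s : ℝ≥0))) := by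
    refine (hsum.sub hsum2).congr_fun fun s => ?_
    rw [intervalIntegral.integral_sub (intervalIntegrable_of_isLocallyBounded hg hgb _ _)
      intervalIntegrable_const, intervalIntegral.integral_const, integral_smul_measure,
      integral_dirac, ENNReal.toReal_ofReal (sub_nonneg.2 (hS s s.2).1)]
  refine ⟨hint, hil hfin, hil hηfin,
    integrableOn_comp hηfin hx.measurable hg hgb fun s hs => (hxK s hs).1,
    hsum3.summable, hsum.summable, ?_, e2, e3⟩
  rw [e2, hsum.tsum_eq, hsum3.tsum_eq, hμ, integral_add_measure
    (hli.mono_measure (Measure.le_add_right le_rfl)) (hli.mono_measure (Measure.le_add_left le_rfl))]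
  ring

/-- Sums over the upward jumps and the downward jumps, where the terms change sign, combine to a sum
over all the jumps. -/
theorem tsum_jumps_sub {t : ℝ≥0} {f h : ℝ≥0 → ℝ} (hu : Summable fun s : upJumps x t => f s)
    (hd : Summable fun s : downJumps x t => h s) (hfh : ∀ s, f s = -h s) :
    Summable (fun s : jumps x t => f s) ∧
      ∑' s : jumps x t, f s = (∑' s : upJumps x t, f s) - ∑' s : downJumps x t, h s := by
  have hd' : HasSum (f ∘ ((↑) : downJumps x t → ℝ≥0)) (-∑' s : downJumps x t, h s) := by
    refine hd.hasSum.neg.congr_fun fun s => ?_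
    exact hfh s
  have H := HasSum.add_disjoint (disjoint_upJumps_downJumps x t) hu.hasSum hd'
  rw [← jumps_eq, ← sub_eq_add_neg] at H
  exact ⟨H.summable, H.tsum_eq⟩

theorem upMeasure_contPart_jumpTimes (hx : IsCadlagLFV x) :
    upMeasure (contPart x) (jumpTimes x) = 0 := by
  rw [upMeasure_contPart hx, Measure.restrict_apply (countable_jumpTimes hx).measurableSet]
  simp

theorem downMeasure_contPart_jumpTimes (hx : IsCadlagLFV x) :
    downMeasure (contPart x) (jumpTimes x) = 0 := by
  rw [downMeasure_contPart hx, Measure.restrict_apply (countable_jumpTimes hx).measurableSet]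
  simp

end LevelCrossing

theorem theorem1 (x : ℝ≥0 → ℝ) (hx : IsCadlagLFV x) (t : ℝ≥0) (ht : 0 < t) :
    (Measurable (fun z => upCrossings x 0 t z) ∧ (∀ᵐ z : ℝ, upCrossings x 0 t z ≠ ⊤) ∧
      ∀ A : Set ℝ, MeasurableSet A →
        ∫⁻ z in A, ((upCrossings x 0 t z : ℕ∞) : ℝ≥0∞) =
          upMeasure (contPart x) (Ioc 0 t ∩ x ⁻¹' A) +
            ∑' s : upJumps x t, volume (A ∩ Ioo (Function.leftLim x s) (x s))) ∧
    (Measurable (fun z => downCrossings x 0 t z) ∧ (∀ᵐ z : ℝ, downCrossings x 0 t z ≠ ⊤) ∧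
      ∀ A : Set ℝ, MeasurableSet A →
        ∫⁻ z in A, ((downCrossings x 0 t z : ℕ∞) : ℝ≥0∞) =
          downMeasure (contPart x) (Ioc 0 t ∩ x ⁻¹' A) +
            ∑' s : downJumps x t, volume (A ∩ Ioo (x s) (Function.leftLim x s))) ∧
    (Measurable (fun z => crossings x 0 t z) ∧ (∀ᵐ z : ℝ, crossings x 0 t z ≠ ⊤) ∧
      ∀ A : Set ℝ, MeasurableSet A →
        ∫⁻ z in A, ((crossings x 0 t z : ℕ∞) : ℝ≥0∞) =
          variationMeasure (contPart x) (Ioc 0 t ∩ x ⁻¹' A) +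
            ∑' s : jumps x t, volume (A ∩ Ioo (min (Function.leftLim x s) (x s)) (max (Function.leftLim x s) (x s)))) ∧
    (∀ g : ℝ → ℝ, Measurable g → IsLocallyBounded g →
      (Integrable (fun z => ((upCrossings x 0 t z).toNat : ℝ) * g z) ∧
        IntegrableOn (fun s => g (Function.leftLim x s)) (Ioc 0 t) (upMeasure x) ∧
        IntegrableOn (fun s => g (Function.leftLim x s)) (Ioc 0 t) (upMeasure (contPart x)) ∧
        IntegrableOn (fun s => g (x s)) (Ioc 0 t) (upMeasure (contPart x)) ∧
        Summable (fun s : upJumps x t =>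
          ∫ z in (Function.leftLim x s)..(x s), (g z - g (Function.leftLim x s))) ∧
        Summable (fun s : upJumps x t => ∫ z in (Function.leftLim x s)..(x s), g z) ∧
        ∫ z, ((upCrossings x 0 t z).toNat : ℝ) * g z =
          (∫ s in Ioc 0 t, g (Function.leftLim x s) ∂(upMeasure x)) +
            ∑' s : upJumps x t, ∫ z in (Function.leftLim x s)..(x s), (g z - g (Function.leftLim x s)) ∧
        ∫ z, ((upCrossings x 0 t z).toNat : ℝ) * g z =
          (∫ s in Ioc 0 t, g (Function.leftLim x s) ∂(upMeasure (contPart x))) +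
            ∑' s : upJumps x t, ∫ z in (Function.leftLim x s)..(x s), g z ∧
        ∫ z, ((upCrossings x 0 t z).toNat : ℝ) * g z =
          (∫ s in Ioc 0 t, g (x s) ∂(upMeasure (contPart x))) +
            ∑' s : upJumps x t, ∫ z in (Function.leftLim x s)..(x s), g z) ∧
      (Integrable (fun z => ((downCrossings x 0 t z).toNat : ℝ) * g z) ∧
        IntegrableOn (fun s => g (Function.leftLim x s)) (Ioc 0 t) (downMeasure x) ∧
        IntegrableOn (fun s => g (Function.leftLim x s)) (Ioc 0 t) (downMeasure (contPart x)) ∧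
        IntegrableOn (fun s => g (x s)) (Ioc 0 t) (downMeasure (contPart x)) ∧
        Summable (fun s : downJumps x t =>
          ∫ z in (x s)..(Function.leftLim x s), (g z - g (Function.leftLim x s))) ∧
        Summable (fun s : downJumps x t => ∫ z in (x s)..(Function.leftLim x s), g z) ∧
        ∫ z, ((downCrossings x 0 t z).toNat : ℝ) * g z =
          (∫ s in Ioc 0 t, g (Function.leftLim x s) ∂(downMeasure x)) +
            ∑' s : downJumps x t, ∫ z in (x s)..(Function.leftLim x s), (g z - g (Function.leftLim x s)) ∧
        ∫ z, ((downCrossings x 0 t z).toNat : ℝ) * g z =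
          (∫ s in Ioc 0 t, g (Function.leftLim x s) ∂(downMeasure (contPart x))) +
            ∑' s : downJumps x t, ∫ z in (x s)..(Function.leftLim x s), g z ∧
        ∫ z, ((downCrossings x 0 t z).toNat : ℝ) * g z =
          (∫ s in Ioc 0 t, g (x s) ∂(downMeasure (contPart x))) +
            ∑' s : downJumps x t, ∫ z in (x s)..(Function.leftLim x s), g z) ∧
      (Integrable (fun z => (((upCrossings x 0 t z).toNat : ℝ) - ((downCrossings x 0 t z).toNat : ℝ)) * g z) ∧
        Summable (fun s : jumps x t =>
          ∫ z in (Function.leftLim x s)..(x s), (g z - g (Function.leftLim x s))) ∧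
        Summable (fun s : jumps x t => ∫ z in (Function.leftLim x s)..(x s), g z) ∧
        ∫ z, (((upCrossings x 0 t z).toNat : ℝ) - ((downCrossings x 0 t z).toNat : ℝ)) * g z =
          signedIntegral x (Ioc 0 t) (fun s => g (Function.leftLim x s)) +
            ∑' s : jumps x t, ∫ z in (Function.leftLim x s)..(x s), (g z - g (Function.leftLim x s)) ∧
        ∫ z, (((upCrossings x 0 t z).toNat : ℝ) - ((downCrossings x 0 t z).toNat : ℝ)) * g z =
          signedIntegral (contPart x) (Ioc 0 t) (fun s => g (Function.leftLim x s)) +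
            ∑' s : jumps x t, ∫ z in (Function.leftLim x s)..(x s), g z ∧
        ∫ z, (((upCrossings x 0 t z).toNat : ℝ) - ((downCrossings x 0 t z).toNat : ℝ)) * g z =
          signedIntegral (contPart x) (Ioc 0 t) (fun s => g (x s)) +
            ∑' s : jumps x t, ∫ z in (Function.leftLim x s)..(x s), g z) ∧
      (Integrable (fun z => ((crossings x 0 t z).toNat : ℝ) * g z) ∧
        IntegrableOn (fun s => g (Function.leftLim x s)) (Ioc 0 t) (variationMeasure x) ∧
        IntegrableOn (fun s => g (Function.leftLim x s)) (Ioc 0 t) (variationMeasure (contPart x)) ∧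
        IntegrableOn (fun s => g (x s)) (Ioc 0 t) (variationMeasure (contPart x)) ∧
        Summable (fun s : jumps x t =>
          ∫ z in (min (Function.leftLim x s) (x s))..(max (Function.leftLim x s) (x s)), (g z - g (Function.leftLim x s))) ∧
        Summable (fun s : jumps x t => ∫ z in (min (Function.leftLim x s) (x s))..(max (Function.leftLim x s) (x s)), g z) ∧
        ∫ z, ((crossings x 0 t z).toNat : ℝ) * g z =
          (∫ s in Ioc 0 t, g (Function.leftLim x s) ∂(variationMeasure x)) +
            ∑' s : jumps x t, ∫ z in (min (Function.leftLim x s) (x s))..(max (Function.leftLim x s) (x s)), (g z - g (Function.leftLim x s)) ∧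
        ∫ z, ((crossings x 0 t z).toNat : ℝ) * g z =
          (∫ s in Ioc 0 t, g (Function.leftLim x s) ∂(variationMeasure (contPart x))) +
            ∑' s : jumps x t, ∫ z in (min (Function.leftLim x s) (x s))..(max (Function.leftLim x s) (x s)), g z ∧
        ∫ z, ((crossings x 0 t z).toNat : ℝ) * g z =
          (∫ s in Ioc 0 t, g (x s) ∂(variationMeasure (contPart x))) +
            ∑' s : jumps x t, ∫ z in (min (Function.leftLim x s) (x s))..(max (Function.leftLim x s) (x s)), g z)) := by
  refine ⟨⟨measurable_upCrossings hx t, ae_upCrossings_ne_top hx t,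
      fun A hA => setLIntegral_upCrossings hx ht hA⟩,
    ⟨measurable_downCrossings hx t, ae_downCrossings_ne_top hx t,
      fun A hA => setLIntegral_downCrossings hx ht hA⟩,
    ⟨measurable_crossings hx t, ae_crossings_ne_top hx t,
      fun A hA => setLIntegral_crossings hx ht hA⟩, fun g hg hgb => ?_⟩
  obtain ⟨K, hK⟩ := exists_bound_path hx t
  have hu := occupation_formula hx (measurable_upCrossings hx t) (ae_upCrossings_ne_top hx t)
    (l := Function.leftLim x) (r := x) hK
    (fun s hs => ⟨(leftLim_lt_of_mem_upJumps hs).le, (hK s hs.2.1).2, (hK s hs.2.1).1⟩)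
    (upMeasure_Ioc_ne_top hx 0 t) (restrict_upMeasure hx t) (upMeasure_contPart_jumpTimes hx)
    (fun A hA => setLIntegral_upCrossings hx ht hA) hg hgb
  have hd := occupation_formula hx (measurable_downCrossings hx t) (ae_downCrossings_ne_top hx t)
    (l := x) (r := Function.leftLim x) hK
    (fun s hs => ⟨(lt_leftLim_of_mem_downJumps hs).le, (hK s hs.2.1).1, (hK s hs.2.1).2⟩)
    (downMeasure_Ioc_ne_top hx 0 t) (by simpa [jump] using restrict_downMeasure hx t)
    (downMeasure_contPart_jumpTimes hx)
    (fun A hA => setLIntegral_downCrossings hx ht hA) hg hgb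
  have hn := occupation_formula hx (measurable_crossings hx t) (ae_crossings_ne_top hx t)
    (l := fun s => min (Function.leftLim x s) (x s)) (r := fun s => max (Function.leftLim x s) (x s))
    hK
    (fun s hs => ⟨min_le_max, ⟨le_min (hK s hs.2.1).2.1 (hK s hs.2.1).1.1,
      min_le_of_left_le (hK s hs.2.1).2.2⟩, ⟨le_max_of_le_left (hK s hs.2.1).2.1,
      max_le (hK s hs.2.1).2.2 (hK s hs.2.1).1.2⟩⟩)
    (variationMeasure_Ioc_ne_top hx 0 t)
    (by simpa only [max_sub_min_eq_abs, jump] using restrict_variationMeasure hx t)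
    (by rw [variationMeasure_eq (isCadlagLFV_contPart hx), Measure.add_apply,
      upMeasure_contPart_jumpTimes hx, downMeasure_contPart_jumpTimes hx, add_zero])
    (fun A hA => setLIntegral_crossings hx ht hA) hg hgb
  refine ⟨hu, hd, ?_, hn⟩
  obtain ⟨u1, -, -, -, u2, u3, u4, u5, u6⟩ := hu
  obtain ⟨d1, -, -, -, d2, d3, d4, d5, d6⟩ := hd
  obtain ⟨s1, e1⟩ := tsum_jumps_sub
    (f := fun s => ∫ z in (Function.leftLim x s)..(x s), (g z - g (Function.leftLim x s)))
    (h := fun s => ∫ z in (x s)..(Function.leftLim x s), (g z - g (Function.leftLim x s)))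
    u2 d2 fun s => intervalIntegral.integral_symm _ _
  obtain ⟨s2, e2⟩ := tsum_jumps_sub (f := fun s => ∫ z in (Function.leftLim x s)..(x s), g z)
    (h := fun s => ∫ z in (x s)..(Function.leftLim x s), g z)
    u3 d3 fun s => intervalIntegral.integral_symm _ _
  have hsub : ∫ z, (((upCrossings x 0 t z).toNat : ℝ) - ((downCrossings x 0 t z).toNat : ℝ)) * g z =
      (∫ z, ((upCrossings x 0 t z).toNat : ℝ) * g z) -
        ∫ z, ((downCrossings x 0 t z).toNat : ℝ) * g z := by
    simp only [sub_mul]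
    exact integral_sub u1 d1
  refine ⟨by simp only [sub_mul]; exact u1.sub d1, s1, s2, ?_, ?_, ?_⟩
  · rw [hsub, u4, d4, e1, signedIntegral]
    ring
  · rw [hsub, u5, d5, e2, signedIntegral]
    ring
  · rw [hsub, u6, d6, e2, signedIntegral]
    ring
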